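/- Let $h_*(t)=e^{-t/2}/t$ for $t>0$, and let $H(h_*)$ be the integral Hankel operator $(H(h_*)f)(t)=\int_0^\infty h_*(t+s)f(s)\,ds$ on the complex space $L^2(\mathbb R_+)$, $\mathbb R_+=(0,\infty)$. Let $K_\nu$ be the modified Bessel function of the third kind (Macdonald function), $K_\nu(z)=\int_0^\infty e^{-z\cosh u}\cosh(\nu u)\,du$ for $\operatorname{Re}z>0$, and for $k>0$, $t>0$ set $$\psi_k(t)=\frac1\pi\sqrt{2k\sinh(\pi k)}\;t^{-1/2}K_{ik}(t/2),\qquad \lambda(k)=\frac{\pi}{\cosh(\pi k)} .$$ Then $H(h_*)$ is a bounded operator on $L^2(\mathbb R_+)$, and there is a unitary operator $U_0:L^2(\mathbb R_+)\to L^2(0,\pi)$ (unique, by density) such that $$(U_0\varphi)(\lambda)=\bigl|\tfrac{d\lambda}{dk}(k)\bigr|^{-1/2}\int_0^\infty \varphi(t)\psi_k(t)\,dt,\qquad \lambda=\lambda(k)\in(0,\pi),\quad \varphi\in C_c^\infty(\mathbb R_+);$$ it diagonalises $H(h_*)$: $U_0H(h_*)U_0^*$ is multiplication by the independent variable $\lambda$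 on $L^2(0,\pi)$. Let $q(t)=|\log t|^{-1}$ for $t\in(0,1/2)$ and $q(t)=(\log 2)^{-1}$ for $t\ge 1/2$, and for $\beta>0$ let $Q^\beta$ be the bounded operator of multiplication by $q(t)^\beta$ on $L^2(\mathbb R_+)$. Then, for every $\beta>1/2$ and every $\gamma$ with $0<\gamma<\min\{1,\beta-1/2\}$, the operator $Q^\beta$ is strongly $H(h_*)$-smooth with exponent $\gamma$ on every compact subinterval of $(0,\pi)$, in the following sense: there are bounded linear functionals $f\mapsto (U_0Q^\beta f)(\lambda)$ on $L^2(\mathbb R_+)$, $\lambda\in(0,\pi)$, such that for each $f\in L^2(\mathbb R_+)$ the function $\lambda\mapsto(U_0Q^\beta f)(\lambda)$ represents the element $U_0Q^\beta f$ of $L^2(0,\pi)$ (almost everywhere), and for every compact interval $\delta\subset(0,\pi)$ there is a constant $C$ (depending only on $\beta,\gamma,\delta$) such that for all $f\in L^2(\mathbb R_+)$ $$|(U_0Q^\beta f)(\lambda)|\le C\|f\|,\quad \lambda\in\delta,$$ $$|(U_0Q^\beta f)(\lambda)-(U_0Q^\beta f)(\lambda')|\le C|\lambda-\lambda'|^\gamma\|f\|,\quad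 \lambda,\lambda'\in\delta .$$ -/

import Mathlib

open MeasureTheory Set
open scoped ENNReal ContDiff

noncomputable section

namespace HankelSmooth

/-- The complex Hilbert space `L²(s)` of a set `s ⊆ ℝ` with Lebesgue measure. -/
abbrev L2 (s : Set ℝ) : Type := Lp ℂ 2 (volume.restrict s)

/-- The bounded operator on `L²(s)` of multiplication by an essentially bounded function `m`. -/
def mulOp {s : Set ℝ} (m : ℝ → ℂ) (hm : MemLp m ∞ (volume.restrict s)) : L2 s →L[ℂ] L2 s :=
  (ContinuousLinearMap.mul ℂ ℂ).holderL (volume.restrict s) ∞ 2 2 (hm.toLp m)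

theorem mulOp_coeFn {s : Set ℝ} (m : ℝ → ℂ) (hm : MemLp m ∞ (volume.restrict s)) (f : L2 s) :
    ∀ᵐ x ∂volume.restrict s, mulOp m hm f x = m x * f x := by
  filter_upwards [(ContinuousLinearMap.mul ℂ ℂ).coeFn_holder (r := 2) (hm.toLp m) f,
    hm.coeFn_toLp] with x h1 h2
  rw [← h2]
  exact h1

/-- The modified Bessel function of the third kind (Macdonald function) `K_ν(z)`, `Re z > 0`. -/
def besselK (ν z : ℂ) : ℂ :=
  ∫ u in Ioi (0 : ℝ), Complex.exp (-z * (Real.cosh u : ℂ)) * Complex.cosh (ν * (u : ℂ))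

/-- `ψ_k(t) = π⁻¹ (2 k sinh (π k))^{1/2} t^{-1/2} K_{ik}(t/2)` for `k > 0`, `t > 0`. -/
def psi (k t : ℝ) : ℂ :=
  ((1 / Real.pi * √(2 * k * Real.sinh (Real.pi * k)) * t ^ (-(1 / 2) : ℝ) : ℝ) : ℂ)
    * besselK (Complex.I * (k : ℂ)) ((t / 2 : ℝ) : ℂ)

/-- `λ(k) = π / cosh (π k)`, a decreasing bijection of `(0, ∞)` onto `(0, π)`. -/
def lam (k : ℝ) : ℝ := Real.pi / Real.cosh (Real.pi * k)

/-- The integral transform `(Uφ)(k) = ∫_0^∞ φ(t) ψ_k(t) dt`. -/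
def transformU (φ : ℝ → ℂ) (k : ℝ) : ℂ := ∫ t in Ioi (0 : ℝ), φ t * psi k t

/-- `φ ∈ C_c^∞((0, ∞))`. -/
structure IsTest (φ : ℝ → ℂ) : Prop where
  smooth : ContDiff ℝ ∞ φ
  compact : HasCompactSupport φ
  support : tsupport φ ⊆ Ioi 0

theorem IsTest.memLp {φ : ℝ → ℂ} (hφ : IsTest φ) : MemLp φ 2 (volume.restrict (Ioi (0 : ℝ))) :=
  (hφ.smooth.continuous.memLp_of_hasCompactSupport hφ.compact).restrict _

/-- `U₀` is the continuous extension of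
`(U₀ φ)(λ) = |dλ/dk|^{-1/2} (Uφ)(k)`, `λ = λ(k) ∈ (0, π)`, from `C_c^∞((0, ∞))` to `L²(0, ∞)`. -/
def ExtendsTransform (U₀ : L2 (Ioi 0) ≃ₗᵢ[ℂ] L2 (Ioo 0 Real.pi)) : Prop :=
  ∀ (φ : ℝ → ℂ) (hφ : IsTest φ), ∀ᵐ x ∂volume.restrict (Ioo (0 : ℝ) Real.pi),
    ∀ k : ℝ, 0 < k → lam k = x →
      U₀ (hφ.memLp.toLp φ) x = ((|deriv lam k| ^ (-(1 / 2) : ℝ) : ℝ) : ℂ) * transformU φ k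

/-- The kernel function `h_*(t) = e^{-t/2} / t`. -/
def hStar (t : ℝ) : ℝ := Real.exp (-t / 2) / t

/-- `H` is the integral Hankel operator on `L²(0, ∞)` with kernel function `h`:
`(H f)(t) = ∫_0^∞ h(t + s) f(s) ds`. -/
def IsHankel (h : ℝ → ℝ) (H : L2 (Ioi 0) →L[ℂ] L2 (Ioi 0)) : Prop :=
  ∀ f : L2 (Ioi 0), ∀ᵐ t ∂volume.restrict (Ioi (0 : ℝ)),
    IntegrableOn (fun s ↦ (h (t + s) : ℂ) * f s) (Ioi 0) ∧
      H f t = ∫ s in Ioi (0 : ℝ), (h (t + s) : ℂ) * f s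

theorem memLp_id : MemLp (fun x : ℝ ↦ (x : ℂ)) ∞ (volume.restrict (Ioo (0 : ℝ) Real.pi)) := by
  refine memLp_top_of_bound Complex.measurable_ofReal.aestronglyMeasurable Real.pi ?_
  filter_upwards [ae_restrict_mem measurableSet_Ioo] with x hx
  rw [Complex.norm_real, Real.norm_eq_abs, abs_of_pos hx.1]
  exact hx.2.le

/-- The unitary operator `U₀` reduces `H` to multiplication by the independent variable on
`L²(0, π)`, that is `U₀ H U₀* = M_λ`. -/
def Diagonalises (U₀ : L2 (Ioi 0) ≃ₗᵢ[ℂ] L2 (Ioo 0 Real.pi))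
    (H : L2 (Ioi 0) →L[ℂ] L2 (Ioi 0)) : Prop :=
  ∀ g : L2 (Ioo 0 Real.pi), U₀ (H (U₀.symm g)) = mulOp (fun x : ℝ ↦ (x : ℂ)) memLp_id g

/-- `q(t) = |log t|⁻¹` on `(0, 1/2)` and `q(t) = (log 2)⁻¹` for `t ≥ 1/2`. -/
def q (t : ℝ) : ℝ := if t < 1 / 2 then |Real.log t|⁻¹ else (Real.log 2)⁻¹

theorem q_nonneg (t : ℝ) : 0 ≤ q t := by
  unfold q
  split_ifs
  · positivity
  · exact inv_nonneg.2 (Real.log_nonneg (by norm_num))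

theorem q_le {t : ℝ} (ht : 0 < t) : q t ≤ (Real.log 2)⁻¹ := by
  unfold q
  split_ifs with h
  · have h2 : 0 < Real.log 2 := Real.log_pos (by norm_num)
    refine inv_anti₀ h2 ?_
    have h3 : Real.log t ≤ Real.log (1 / 2) := Real.log_le_log ht h.le
    rw [one_div, Real.log_inv] at h3
    rw [abs_of_nonpos (by linarith)]
    linarith
  · exact le_rfl

theorem measurable_q : Measurable q :=
  Measurable.ite measurableSet_Iio (continuous_abs.measurable.comp Real.measurable_log).inv
    measurable_const

theorem memLp_q_rpow {β : ℝ} (hβ : 0 < β) :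
    MemLp (fun t ↦ ((q t ^ β : ℝ) : ℂ)) ∞ (volume.restrict (Ioi (0 : ℝ))) := by
  refine memLp_top_of_bound
    (Complex.measurable_ofReal.comp (measurable_q.pow_const β)).aestronglyMeasurable
    ((Real.log 2)⁻¹ ^ β) ?_
  filter_upwards [ae_restrict_mem measurableSet_Ioi] with t ht
  rw [Complex.norm_real, Real.norm_eq_abs, abs_of_nonneg (Real.rpow_nonneg (q_nonneg t) β)]
  exact Real.rpow_le_rpow (q_nonneg t) (q_le ht) hβ.le

/-- The operator `Q^β`, `β > 0`, of multiplication by `q(t)^β` on `L²(0, ∞)`. -/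
def Qpow (β : ℝ) (hβ : 0 < β) : L2 (Ioi 0) →L[ℂ] L2 (Ioi 0) :=
  mulOp (fun t ↦ ((q t ^ β : ℝ) : ℂ)) (memLp_q_rpow hβ)

/-- Strong smoothness with exponent `γ` of a bounded self-adjoint operator `G` on all compact
subintervals `[a, b]` of `(0, π)`, relative to the operator diagonalised by `U₀`:
the maps `f ↦ (U₀ G f)(λ)` are (represented by) bounded linear functionals `Z λ`, and
`Z` is bounded and norm-Hölder continuous with exponent `γ` on `[a, b]`.
Being continuous, `Z` is uniquely determined on `(0, π)` by the almost everywhere identity. -/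
def IsStronglySmooth (U₀ : L2 (Ioi 0) ≃ₗᵢ[ℂ] L2 (Ioo 0 Real.pi))
    (G : L2 (Ioi 0) →L[ℂ] L2 (Ioi 0)) (γ : ℝ) : Prop :=
  ∃ Z : ℝ → (L2 (Ioi 0) →L[ℂ] ℂ),
    (∀ f : L2 (Ioi 0), ∀ᵐ x ∂volume.restrict (Ioo (0 : ℝ) Real.pi), U₀ (G f) x = Z x f) ∧
    ∀ a b : ℝ, 0 < a → a ≤ b → b < Real.pi → ∃ C : ℝ, ∀ f : L2 (Ioi 0),
      (∀ x ∈ Icc a b, ‖Z x f‖ ≤ C * ‖f‖) ∧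
      ∀ x ∈ Icc a b, ∀ y ∈ Icc a b, ‖Z x f - Z y f‖ ≤ C * |x - y| ^ γ * ‖f‖

end HankelSmooth

end

/-! The proof never starts from the boundedness of the Hankel operator or from a spectral theorem.
The unitary `U` comes from two explicit total families with the same Gram matrix, and everything
else is read off from it.

On the `t` side the family is `expVec v`, that is `t^{1/2} e^{-(t/2) cosh v}`. Its factor `t^{1/2}`
cancels the `t^{-1/2}` in the kernel, so its formal transform is the Laplace transform of `K_{ik}`
(`laplace_besselK`), a multiple of `sin (kv)`; this is `sineVec v`. Both Gram matrices equal `4 /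
(cosh v + cosh w)^2` (`inner_expVec`, `inner_sineVec`). Totality is injectivity of the Laplace
transform on one side and of the sine transform on the other. All closed forms come from one Beta
integral (`fourier_cosh_rpow`).

Testing against the family shows that `U` is the integral operator with kernel `kern`
(`ae_eq_integral_kern`), hence extends the prescribed transform. The Hankel operator is defined as
`U* M_λ U`, which makes boundedness and diagonalisation immediate; that it has kernel `hStar (t +
s)` follows because `t^{-1/2} K_{ik}(t/2)` is a generalised eigenfunction with eigenvalue `lam k`
(`hankel_besselK`): in the variable `u` dual to `k` the operator is convolution with a hyperbolic
secant.

For smoothness, `k K_{ik}(x)` is the integral of `sin (ku)` against a positive measure in `u` of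
mass `e^{-x}` (`mul_besselK_I_mul`). It is therefore bounded uniformly in `k`, and Hölder in `k` at
the price of a factor `|log x|^γ` near `x = 0` (`abs_sinBessel_sub_le`). The weight `q^β` absorbs
this factor, leaving `q^{β-γ} t^{-1/2}`, which is square integrable at zero when `2(β-γ) > 1`.
Cauchy–Schwarz then gives the two estimates. -/

namespace HankelSmooth

open Filter Topology FourierTransform

/-! ### Unitary operators from equal Gram matrices. -/

/-- The span of a family with trivial orthogonal complement is dense. -/
theorem denseRange_linearCombination {ι G : Type*} [NormedAddCommGroup G] [InnerProductSpace ℂ G]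
    [CompleteSpace G] (ψ : ι → G) (hψ : ∀ x, (∀ i, inner ℂ (ψ i) x = 0) → x = 0) :
    DenseRange (Finsupp.linearCombination ℂ ψ) := by
  have h1 : (LinearMap.range (Finsupp.linearCombination ℂ ψ)).topologicalClosure = ⊤ := by
    rw [Submodule.topologicalClosure_eq_top_iff, Submodule.eq_bot_iff]
    intro x hx
    refine hψ x fun i ↦ ?_
    refine (Submodule.mem_orthogonal _ _).1 hx (ψ i) ⟨Finsupp.single i 1, by simp⟩
  have h2 := Submodule.dense_iff_topologicalClosure_eq_top.2 h1
  simpa [DenseRange, LinearMap.coe_range] using h2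

/-- Two total families with the same Gram matrix are intertwined by a unitary operator. -/
theorem exists_linearIsometryEquiv_of_inner_eq {ι E F : Type*}
    [NormedAddCommGroup E] [InnerProductSpace ℂ E] [CompleteSpace E]
    [NormedAddCommGroup F] [InnerProductSpace ℂ F] [CompleteSpace F]
    (φ : ι → E) (e : ι → F) (h : ∀ i j, inner ℂ (φ i) (φ j) = inner ℂ (e i) (e j))
    (hφ : ∀ x, (∀ i, inner ℂ (φ i) x = 0) → x = 0)
    (he : ∀ x, (∀ i, inner ℂ (e i) x = 0) → x = 0) :
    ∃ U : E ≃ₗᵢ[ℂ] F, ∀ i, U (φ i) = e i := by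
  have inner_eq : ∀ c : ι →₀ ℂ, inner ℂ (Finsupp.linearCombination ℂ e c)
      (Finsupp.linearCombination ℂ e c) = inner ℂ (Finsupp.linearCombination ℂ φ c)
      (Finsupp.linearCombination ℂ φ c) := by
    intro c
    simp only [Finsupp.linearCombination_apply, Finsupp.sum, sum_inner, inner_sum,
      inner_smul_left, inner_smul_right, h]
  have hnorm : ∀ c : ι →₀ ℂ, ‖Finsupp.linearCombination ℂ e (LinearEquiv.refl ℂ (ι →₀ ℂ) c)‖
      = ‖Finsupp.linearCombination ℂ φ c‖ := by
    intro c
    have h3 := inner_eq c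
    rw [inner_self_eq_norm_sq_to_K, inner_self_eq_norm_sq_to_K] at h3
    have h4 : ‖Finsupp.linearCombination ℂ e c‖ ^ 2 = ‖Finsupp.linearCombination ℂ φ c‖ ^ 2 := by
      exact_mod_cast h3
    exact (pow_left_inj₀ (norm_nonneg _) (norm_nonneg _) two_ne_zero).1 h4
  -- The identity on coefficient vectors is isometric for the two norms they induce, so it passes to
  -- the dense ranges and extends to the completions.
  refine ⟨(LinearEquiv.refl ℂ (ι →₀ ℂ)).extendOfIsometry (Finsupp.linearCombination ℂ φ)
    (Finsupp.linearCombination ℂ e) (denseRange_linearCombination φ hφ)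
    (denseRange_linearCombination e he) hnorm, fun i ↦ ?_⟩
  have h5 := LinearEquiv.extendOfIsometry_eq (LinearEquiv.refl ℂ (ι →₀ ℂ))
    (Finsupp.linearCombination ℂ φ) (Finsupp.linearCombination ℂ e) (denseRange_linearCombination φ hφ)
    (denseRange_linearCombination e he) hnorm
    (Finsupp.single i 1)
  simpa using h5

/-! ### Injectivity of the Laplace, Fourier and sine transforms. -/

theorem integral_mul_polynomial_exp_eq_zero {g : ℝ → ℂ} (hg : IntegrableOn g (Ioi 0))
    (h : ∀ n : ℕ, ∫ t in Ioi (0 : ℝ), g t * (Real.exp (-(n * t)) : ℂ) = 0) (p : Polynomial ℝ) :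
    IntegrableOn (fun t ↦ g t * (p.eval (Real.exp (-t)) : ℝ)) (Ioi 0) ∧
    ∫ t in Ioi (0 : ℝ), g t * ((p.eval (Real.exp (-t)) : ℝ) : ℂ) = 0 := by
  induction p using Polynomial.induction_on' with
  | add p q hp hq =>
    simp only [Polynomial.eval_add, Complex.ofReal_add, mul_add]
    refine ⟨hp.1.add hq.1, ?_⟩
    rw [integral_add hp.1 hq.1, hp.2, hq.2, add_zero]
  | monomial n a =>
    have h1 : ∀ t : ℝ, g t * (((Polynomial.monomial n a).eval (Real.exp (-t)) : ℝ) : ℂ)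
        = (a : ℂ) * (g t * (Real.exp (-(n * t)) : ℂ)) := by
      intro t
      rw [Polynomial.eval_monomial, ← Real.exp_nat_mul]
      push_cast
      ring_nf
    simp only [h1]
    constructor
    · refine Integrable.const_mul ?_ _
      refine Integrable.mul_bdd (c := 1) hg ?_ ?_
      · exact Continuous.aestronglyMeasurable (by fun_prop)
      · filter_upwards [ae_restrict_mem measurableSet_Ioi] with t ht
        have ht' : (0 : ℝ) < t := ht
        rw [Complex.norm_real, Real.norm_eq_abs, abs_of_pos (Real.exp_pos _)]
        exact Real.exp_le_one_iff.2 (by simp only [Left.neg_nonpos_iff]; positivity)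
    · rw [integral_const_mul, h, mul_zero]

/-- Injectivity of the Laplace transform, tested on the nonnegative integers. -/
theorem ae_eq_zero_of_laplace_eq_zero {g : ℝ → ℂ} (hg : IntegrableOn g (Ioi 0))
    (h : ∀ n : ℕ, ∫ t in Ioi (0 : ℝ), g t * (Real.exp (-(n * t)) : ℂ) = 0) :
    ∀ᵐ t ∂volume.restrict (Ioi (0 : ℝ)), g t = 0 := by
  have key : ∀ χ : ℝ → ℝ, Continuous χ → HasCompactSupport χ →
      ∫ t in Ioi (0 : ℝ), χ t • g t = 0 := by
    intro χ hχ hc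
    obtain ⟨R, hR⟩ : ∃ R : ℝ, ∀ t, R ≤ t → χ t = 0 := by
      obtain ⟨R, hR⟩ := hc.isCompact.bddAbove
      refine ⟨R + 1, fun t ht ↦ image_eq_zero_of_notMem_tsupport fun hmem ↦ ?_⟩
      linarith [hR hmem]
    -- In the variable `x = e^{-t}` the hypothesis says that `g` annihilates all polynomials, so
    -- Weierstrass approximation on `[0, 1]` applies. Truncating at `e^{-R}`, beyond which `χ`
    -- vanishes, makes the function continuous at `x = 0`.
    set f : ℝ → ℝ := fun x ↦ χ (-Real.log (max x (Real.exp (-R)))) with hf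
    have hfc : Continuous f := by
      refine hχ.comp (Continuous.neg (Continuous.log (by fun_prop) fun x ↦ ?_))
      exact (lt_max_of_lt_right (Real.exp_pos _)).ne'
    have hfe : ∀ t, f (Real.exp (-t)) = χ t := by
      intro t
      rcases le_total t R with h1 | h1
      · simp only [hf]
        rw [max_eq_left (Real.exp_le_exp.2 (by linarith)), Real.log_exp, neg_neg]
      · simp only [hf]
        rw [max_eq_right (Real.exp_le_exp.2 (by linarith)), Real.log_exp, neg_neg, hR t h1,
          hR R le_rfl]
    have hbound : ∀ ε > 0, ‖∫ t in Ioi (0 : ℝ), χ t • g t‖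
        ≤ ε * ∫ t in Ioi (0 : ℝ), ‖g t‖ := by
      intro ε hε
      obtain ⟨p, hp⟩ := exists_polynomial_near_of_continuousOn 0 1 f hfc.continuousOn ε hε
      obtain ⟨hpi, hp0⟩ := integral_mul_polynomial_exp_eq_zero hg h p
      have hχi : IntegrableOn (fun t ↦ χ t • g t) (Ioi 0) := by
        obtain ⟨C, hC⟩ := hχ.bounded_above_of_compact_support hc
        exact Integrable.bdd_mul (c := C) (f := fun t ↦ (χ t : ℂ)) hg
          (by exact Continuous.aestronglyMeasurable (by fun_prop))
          (Eventually.of_forall fun t ↦ by simpa using hC t) |>.congr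
          (Eventually.of_forall fun t ↦ by simp)
      have h1 : ∫ t in Ioi (0 : ℝ), χ t • g t = ∫ t in Ioi (0 : ℝ),
          (χ t • g t - g t * ((p.eval (Real.exp (-t)) : ℝ) : ℂ)) := by
        rw [integral_sub hχi hpi, hp0, sub_zero]
      rw [h1, ← integral_const_mul]
      refine norm_integral_le_of_norm_le (hg.norm.const_mul ε) ?_
      filter_upwards [ae_restrict_mem measurableSet_Ioi] with t ht
      have ht' : (0 : ℝ) < t := ht
      have h2 := hp (Real.exp (-t)) ⟨(Real.exp_pos _).le, Real.exp_le_one_iff.2 (by linarith)⟩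
      rw [hfe] at h2
      have h3 : χ t • g t - g t * ((p.eval (Real.exp (-t)) : ℝ) : ℂ)
          = ((χ t - p.eval (Real.exp (-t)) : ℝ) : ℂ) * g t := by
        push_cast
        rw [Complex.real_smul]
        ring
      rw [h3, norm_mul, Complex.norm_real, Real.norm_eq_abs, abs_sub_comm]
      gcongr
    have hI : 0 ≤ ∫ t in Ioi (0 : ℝ), ‖g t‖ := integral_nonneg fun _ ↦ norm_nonneg _
    refine norm_le_zero_iff.1 (le_of_forall_pos_le_add fun δ hδ ↦ ?_)
    refine (hbound (δ / ((∫ t in Ioi (0 : ℝ), ‖g t‖) + 1)) (by positivity)).trans ?_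
    rw [zero_add, div_mul_eq_mul_div, div_le_iff₀ (by positivity)]
    nlinarith
  refine ae_eq_zero_of_integral_contDiff_smul_eq_zero (μ := volume.restrict (Ioi (0 : ℝ)))
    (Integrable.locallyIntegrable hg) fun χ hχ hc ↦ ?_
  exact key χ hχ.continuous hc

/-- Injectivity of the Fourier transform on `L¹(ℝ)`. -/
theorem ae_eq_zero_of_fourier_eq_zero {g : ℝ → ℂ} (hg : Integrable g) (h : ∀ x, 𝓕 g x = 0) :
    ∀ᵐ t, g t = 0 := by
  refine ae_eq_zero_of_integral_contDiff_smul_eq_zero hg.locallyIntegrable fun χ hχ hc ↦ ?_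
  have hχ' : ContDiff ℝ ∞ (fun t ↦ (χ t : ℂ)) := Complex.ofRealCLM.contDiff.comp hχ
  have hc' : HasCompactSupport (fun t ↦ (χ t : ℂ)) := hc.comp_left (g := Complex.ofReal) rfl
  set η : SchwartzMap ℝ ℂ := hc'.toSchwartzMap hχ' with hη
  -- Moving the Fourier transform from `𝓕⁻ η` to `g` turns the integral of `χ g` into an integral
  -- against `𝓕 g = 0`.
  have h1 := VectorFourier.integral_fourierIntegral_smul_eq_flip (L := innerₗ ℝ) (μ := volume)
    (ν := volume) Real.continuous_fourierChar continuous_inner (f := (𝓕⁻ η : SchwartzMap ℝ ℂ)) (g := g)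
    (SchwartzMap.integrable _) hg
  have h2 : ∀ x, VectorFourier.fourierIntegral Real.fourierChar volume (innerₗ ℝ)
      ((𝓕⁻ η : SchwartzMap ℝ ℂ) : ℝ → ℂ) x = (χ x : ℂ) := by
    intro x
    have h3 : 𝓕 (𝓕⁻ η) = η := FourierTransform.fourier_fourierInv_eq η
    have h4 := congrArg (fun ζ : SchwartzMap ℝ ℂ ↦ ζ x) h3
    simp only [SchwartzMap.fourier_coe] at h4
    exact h4
  have h5 : ∀ x, VectorFourier.fourierIntegral Real.fourierChar volume (innerₗ ℝ).flip g x = 0 := by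
    intro x
    rw [flip_innerₗ]
    exact h x
  simp only [h2, h5, smul_zero, integral_zero] at h1
  simpa using h1

theorem integral_real_eq_integral_Ioi_add {E : Type*} [NormedAddCommGroup E] [NormedSpace ℝ E]
    {g : ℝ → E} (hg : Integrable g) :
    ∫ x, g x = ∫ x in Ioi (0 : ℝ), (g x + g (-x)) := by
  rw [integral_add hg.integrableOn hg.comp_neg.integrableOn, integral_comp_neg_Ioi, neg_zero,
    add_comm, ← setIntegral_univ, ← Iic_union_Ioi (a := (0 : ℝ)),
    setIntegral_union (Iic_disjoint_Ioi le_rfl) measurableSet_Ioi hg.integrableOn hg.integrableOn]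

/-- Injectivity of the sine transform on `L¹(0, ∞)`. -/
theorem ae_eq_zero_of_sine_transform_eq_zero {g : ℝ → ℂ} (hg : IntegrableOn g (Ioi 0))
    (h : ∀ v : ℝ, 0 < v → ∫ k in Ioi (0 : ℝ), g k * (Real.sin (k * v) : ℂ) = 0) :
    ∀ᵐ k ∂volume.restrict (Ioi (0 : ℝ)), g k = 0 := by
  have hv : ∀ v : ℝ, ∫ k in Ioi (0 : ℝ), g k * (Real.sin (k * v) : ℂ) = 0 := by
    intro v
    rcases lt_trichotomy v 0 with h1 | h1 | h1
    · have h2 := h (-v) (by linarith)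
      simp only [mul_neg, Real.sin_neg, Complex.ofReal_neg, integral_neg, neg_eq_zero] at h2
      exact h2
    · simp [h1]
    · exact h v h1
  -- The odd extension of `g`: its Fourier transform is `-2i` times the sine transform at `2πx`.
  set G : ℝ → ℂ := fun k ↦ (Ioi (0 : ℝ)).indicator g k - (Ioi (0 : ℝ)).indicator g (-k) with hG
  have hi : Integrable ((Ioi (0 : ℝ)).indicator g) := hg.integrable_indicator measurableSet_Ioi
  have hGi : Integrable G := hi.sub hi.comp_neg
  have hGpos : ∀ k, 0 < k → G k = g k := by
    intro k hk
    simp [hG, indicator, hk, hk.le]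
  have hGodd : ∀ k, G (-k) = - G k := by
    intro k
    simp [hG]
  have h0 : ∀ x, 𝓕 G x = 0 := by
    intro x
    rw [Real.fourier_real_eq_integral_exp_smul, integral_real_eq_integral_Ioi_add]
    · rw [← mul_zero (-2 * Complex.I), ← hv (2 * Real.pi * x), ← integral_const_mul]
      refine setIntegral_congr_fun measurableSet_Ioi fun k hk ↦ ?_
      simp only [hGodd, hGpos k hk, smul_eq_mul]
      rw [Complex.ofReal_sin, Complex.sin]
      push_cast
      have e1 : -(↑k * (2 * ↑Real.pi * ↑x)) * Complex.I = -2 * ↑Real.pi * ↑k * ↑x * Complex.I := by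
        ring
      have e2 : (↑k * (2 * ↑Real.pi * ↑x)) * Complex.I = -2 * ↑Real.pi * -↑k * ↑x * Complex.I := by
        ring
      rw [e1, e2]
      ring_nf
      rw [Complex.I_sq]
      ring
    · refine Integrable.bdd_mul (c := 1) hGi (by exact Continuous.aestronglyMeasurable (by fun_prop))
        (Eventually.of_forall fun k ↦ ?_)
      rw [Complex.norm_exp_ofReal_mul_I]
  have h1 := ae_eq_zero_of_fourier_eq_zero hGi h0
  filter_upwards [ae_restrict_of_ae h1, ae_restrict_mem measurableSet_Ioi] with k hk hk'
  rw [← hGpos k hk', hk]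

/-! ### Fourier transforms of hyperbolic functions. -/

theorem sigmoid_mul_one_sub (u : ℝ) :
    Real.sigmoid u * (1 - Real.sigmoid u) = (2 * Real.cosh (u / 2))⁻¹ ^ 2 := by
  rw [← Real.sigmoid_neg, Real.sigmoid_def, Real.sigmoid_def, neg_neg, ← mul_inv, inv_pow]
  congr 1
  rw [Real.cosh_eq]
  have h1 : Real.exp u = Real.exp (u / 2) ^ 2 := by rw [← Real.exp_nat_mul]; ring_nf
  have h2 : Real.exp (-u) = Real.exp (-(u / 2)) ^ 2 := by rw [← Real.exp_nat_mul]; ring_nf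
  have h3 : Real.exp (u / 2) * Real.exp (-(u / 2)) = 1 := by rw [← Real.exp_add]; simp
  rw [h1, h2]
  linear_combination (Real.exp (u / 2) * Real.exp (-(u / 2)) - 1) * h3

theorem log_sigmoid_sub_log (u : ℝ) :
    Real.log (Real.sigmoid u) - Real.log (1 - Real.sigmoid u) = u := by
  have h0 := Real.sigmoid_pos u
  have h1 := Real.sigmoid_pos (-u)
  rw [← Real.sigmoid_neg, ← Real.sigmoid_mul_rexp_neg, Real.log_mul h0.ne' (Real.exp_pos _).ne',
    Real.log_exp]
  ring

/-- The Beta integrand at exponents `a ± ik` under `x = σ(u)`, with `σ(1 - σ)` as Jacobian. The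
difference of `log σ` and `log (1 - σ)` is `u`, which gives the oscillation; their sum is `-2 log (2
cosh (u/2))`, which gives the power. -/
theorem sigmoid_cpow_mul (a k u : ℝ) :
    (Real.sigmoid u * (1 - Real.sigmoid u)) •
      (((Real.sigmoid u : ℝ) : ℂ) ^ ((a : ℂ) + k * Complex.I - 1)
        * (1 - ((Real.sigmoid u : ℝ) : ℂ)) ^ ((a : ℂ) - k * Complex.I - 1))
      = Complex.exp ((k * u : ℝ) * Complex.I) * (((2 * Real.cosh (u / 2)) ^ (-(2 * a)) : ℝ) : ℂ) := by
  have h0 := Real.sigmoid_pos u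
  have h1 : 0 < 1 - Real.sigmoid u := by linarith [Real.sigmoid_lt_one u]
  have hc : 0 < 2 * Real.cosh (u / 2) := by linarith [Real.cosh_pos (u / 2)]
  have h2 := log_sigmoid_sub_log u
  have h3 : Real.log (Real.sigmoid u) + Real.log (1 - Real.sigmoid u)
      = -2 * Real.log (2 * Real.cosh (u / 2)) := by
    rw [← Real.log_mul h0.ne' h1.ne', sigmoid_mul_one_sub, Real.log_pow, Real.log_inv]
    push_cast
    ring
  have h4 : Real.sigmoid u * (1 - Real.sigmoid u)
      = Real.exp (Real.log (Real.sigmoid u) + Real.log (1 - Real.sigmoid u)) := by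
    rw [Real.exp_add, Real.exp_log h0, Real.exp_log h1]
  have h5 : (1 : ℂ) - ((Real.sigmoid u : ℝ) : ℂ) = ((1 - Real.sigmoid u : ℝ) : ℂ) := by push_cast; rfl
  rw [h4, h5, Complex.cpow_def_of_ne_zero (by exact_mod_cast h0.ne'),
    Complex.cpow_def_of_ne_zero (by exact_mod_cast h1.ne'), Real.rpow_def_of_pos hc,
    ← Complex.ofReal_log h0.le, ← Complex.ofReal_log h1.le, Complex.real_smul, Complex.ofReal_exp,
    Complex.ofReal_exp, ← Complex.exp_add, ← Complex.exp_add, ← Complex.exp_add]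
  congr 1
  generalize Real.log (Real.sigmoid u) = x at *
  generalize Real.log (1 - Real.sigmoid u) = y at *
  generalize Real.log (2 * Real.cosh (u / 2)) = z at *
  have h3' : (x : ℂ) + y = -2 * z := by exact_mod_cast h3
  have h2' : (x : ℂ) - y = u := by exact_mod_cast h2
  push_cast
  linear_combination a * h3' + k * Complex.I * h2'

/-- The Beta integral `B(a + ik, a - ik)` pulled back to the line by the sigmoid. The cases `a =
1/2` and `a = 1`, combined with the reflection formula for Gamma, give every closed form needed
below. -/
theorem fourier_cosh_rpow {a : ℝ} (ha : 0 < a) (k : ℝ) :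
    Integrable (fun u : ℝ ↦ Complex.exp ((k * u : ℝ) * Complex.I)
      * (((2 * Real.cosh (u / 2)) ^ (-(2 * a)) : ℝ) : ℂ)) ∧
    Complex.Gamma (2 * a) * ∫ u : ℝ, Complex.exp ((k * u : ℝ) * Complex.I)
      * (((2 * Real.cosh (u / 2)) ^ (-(2 * a)) : ℝ) : ℂ)
      = Complex.Gamma (a + k * Complex.I) * Complex.Gamma (a - k * Complex.I) := by
  set g : ℝ → ℂ := fun x ↦ (x : ℂ) ^ ((a : ℂ) + k * Complex.I - 1)
    * (1 - (x : ℂ)) ^ ((a : ℂ) - k * Complex.I - 1) with hg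
  have hre1 : 0 < ((a : ℂ) + k * Complex.I).re := by simpa using ha
  have hre2 : 0 < ((a : ℂ) - k * Complex.I).re := by simpa using ha
  have himg : Real.sigmoid '' univ = Ioo 0 1 := by rw [image_univ, Real.range_sigmoid]
  have hd : ∀ x ∈ (univ : Set ℝ), HasDerivWithinAt Real.sigmoid
      (Real.sigmoid x * (1 - Real.sigmoid x)) univ x :=
    fun x _ ↦ (Real.hasDerivAt_sigmoid x).hasDerivWithinAt
  have hpt : ∀ u, |Real.sigmoid u * (1 - Real.sigmoid u)| • g (Real.sigmoid u)
      = Complex.exp ((k * u : ℝ) * Complex.I)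
        * (((2 * Real.cosh (u / 2)) ^ (-(2 * a)) : ℝ) : ℂ) := by
    intro u
    rw [abs_of_nonneg (by rw [sigmoid_mul_one_sub]; positivity)]
    exact sigmoid_cpow_mul a k u
  have hint : IntegrableOn g (Ioo 0 1) := by
    have h1 := Complex.betaIntegral_convergent hre1 hre2
    rw [intervalIntegrable_iff_integrableOn_Ioo_of_le zero_le_one] at h1
    exact h1
  have e1 := integrableOn_image_iff_integrableOn_abs_deriv_smul MeasurableSet.univ hd
    Real.sigmoid_injective.injOn g
  have e2 := integral_image_eq_integral_abs_deriv_smul MeasurableSet.univ hd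
    Real.sigmoid_injective.injOn g
  rw [himg] at e1 e2
  simp only [hpt, integrableOn_univ, setIntegral_univ] at e1 e2
  refine ⟨e1.1 hint, ?_⟩
  rw [← e2, Complex.Gamma_mul_Gamma_eq_betaIntegral hre1 hre2, Complex.betaIntegral,
    intervalIntegral.integral_of_le zero_le_one, integral_Ioc_eq_integral_Ioo]
  congr 2
  ring

theorem integrable_sech : Integrable (fun u : ℝ ↦ (Real.cosh (u / 2))⁻¹) := by
  have h := ((fourier_cosh_rpow (a := 1 / 2) (by norm_num) 0).1.re).const_mul 2
  refine h.congr (Eventually.of_forall fun u ↦ ?_)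
  have hc := Real.cosh_pos (u / 2)
  simp only [zero_mul, Complex.ofReal_zero, Complex.exp_zero, one_mul]
  rw [show -(2 * (1 / 2 : ℝ)) = -1 by norm_num, Real.rpow_neg_one, mul_inv]
  rw [RCLike.re_eq_complex_re, Complex.ofReal_re]
  ring

/-- The Fourier transform of the hyperbolic secant. -/
theorem fourier_sech (k : ℝ) :
    ∫ u : ℝ, Complex.exp ((k * u : ℝ) * Complex.I) * (((Real.cosh (u / 2))⁻¹ : ℝ) : ℂ)
      = ((2 * Real.pi / Real.cosh (Real.pi * k) : ℝ) : ℂ) := by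
  have h := (fourier_cosh_rpow (a := 1 / 2) (by norm_num) k).2
  have h1 : ∀ u : ℝ, Complex.exp ((k * u : ℝ) * Complex.I)
      * (((2 * Real.cosh (u / 2)) ^ (-(2 * (1 / 2 : ℝ))) : ℝ) : ℂ)
      = (1 / 2 : ℂ) * (Complex.exp ((k * u : ℝ) * Complex.I)
        * (((Real.cosh (u / 2))⁻¹ : ℝ) : ℂ)) := by
    intro u
    rw [show -(2 * (1 / 2 : ℝ)) = -1 by norm_num, Real.rpow_neg_one, mul_inv]
    push_cast
    ring
  simp only [h1] at h
  rw [integral_const_mul] at h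
  have h2 : (((1 / 2 : ℝ) : ℂ) - k * Complex.I) = 1 - (((1 / 2 : ℝ) : ℂ) + k * Complex.I) := by
    push_cast
    ring
  rw [h2, Complex.Gamma_mul_Gamma_one_sub,
    show (2 : ℂ) * ((1 / 2 : ℝ) : ℂ) = 1 by push_cast; norm_num, Complex.Gamma_one, one_mul,
    show (Real.pi : ℂ) * (((1 / 2 : ℝ) : ℂ) + k * Complex.I)
      = (Real.pi * k : ℂ) * Complex.I + Real.pi / 2 by push_cast; ring, Complex.sin_add_pi_div_two,
    Complex.cos_mul_I] at h
  have h3 : ((2 * Real.pi / Real.cosh (Real.pi * k) : ℝ) : ℂ)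
      = 2 * (Real.pi / Complex.cosh (Real.pi * k)) := by
    push_cast
    ring
  rw [h3, ← h]
  ring

theorem one_add_cosh (u : ℝ) : 1 + Real.cosh u = 2 * Real.cosh (u / 2) ^ 2 := by
  have h := Real.cosh_two_mul (u / 2)
  have h' := Real.cosh_sq (u / 2)
  rw [show 2 * (u / 2) = u by ring] at h
  linarith

theorem rpow_neg_two_cosh (u : ℝ) :
    (2 * Real.cosh (u / 2)) ^ (-(2 * (1 : ℝ))) = (1 / 2) * (1 + Real.cosh u)⁻¹ := by
  rw [one_add_cosh, mul_one, Real.rpow_neg (by positivity), Real.rpow_two, mul_pow, mul_inv, mul_inv]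
  ring

theorem integrable_inv_one_add_cosh : Integrable (fun u : ℝ ↦ (1 + Real.cosh u)⁻¹) := by
  have h := ((fourier_cosh_rpow one_pos 0).1.re).const_mul 2
  refine h.congr (Eventually.of_forall fun u ↦ ?_)
  simp only [zero_mul, Complex.ofReal_zero, Complex.exp_zero, one_mul]
  rw [rpow_neg_two_cosh]
  rw [RCLike.re_eq_complex_re, Complex.ofReal_re]
  ring

theorem fourier_inv_one_add_cosh {k : ℝ} (hk : k ≠ 0) :
    ∫ u : ℝ, Complex.exp ((k * u : ℝ) * Complex.I) * (((1 + Real.cosh u)⁻¹ : ℝ) : ℂ)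
      = ((2 * Real.pi * (k / Real.sinh (Real.pi * k)) : ℝ) : ℂ) := by
  have h := (fourier_cosh_rpow one_pos k).2
  have h1 : ∀ u : ℝ, Complex.exp ((k * u : ℝ) * Complex.I)
      * (((2 * Real.cosh (u / 2)) ^ (-(2 * (1 : ℝ))) : ℝ) : ℂ)
      = (1 / 2 : ℂ) * (Complex.exp ((k * u : ℝ) * Complex.I)
        * (((1 + Real.cosh u)⁻¹ : ℝ) : ℂ)) := by
    intro u
    rw [rpow_neg_two_cosh]
    push_cast
    ring
  simp only [h1] at h
  rw [integral_const_mul] at h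
  have hkI : (k : ℂ) * Complex.I ≠ 0 := mul_ne_zero (by exact_mod_cast hk) Complex.I_ne_zero
  have hG2 : Complex.Gamma (2 * ((1 : ℝ) : ℂ)) = 1 := by
    have := Complex.Gamma_nat_eq_factorial 1
    rw [show (2 : ℂ) * ((1 : ℝ) : ℂ) = (1 : ℕ) + 1 by push_cast; norm_num, this]
    simp
  rw [hG2, one_mul, show ((1 : ℝ) : ℂ) + k * Complex.I = k * Complex.I + 1 by push_cast; ring,
    Complex.Gamma_add_one _ hkI, Complex.ofReal_one, mul_assoc, Complex.Gamma_mul_Gamma_one_sub,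
    show (Real.pi : ℂ) * (k * Complex.I) = (Real.pi * k : ℂ) * Complex.I by ring,
    Complex.sin_mul_I] at h
  have h3 : (k : ℂ) * Complex.I * (Real.pi / (Complex.sinh (Real.pi * k) * Complex.I))
      = Real.pi * (k / Complex.sinh (Real.pi * k)) := by
    rw [show (k : ℂ) * Complex.I * (Real.pi / (Complex.sinh (Real.pi * k) * Complex.I))
      = Real.pi * (k * Complex.I / (Complex.sinh (Real.pi * k) * Complex.I)) by ring,
      mul_div_mul_right _ _ Complex.I_ne_zero]
  rw [h3] at h
  have h4 : ((2 * Real.pi * (k / Real.sinh (Real.pi * k)) : ℝ) : ℂ)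
      = 2 * (Real.pi * (k / Complex.sinh (Real.pi * k))) := by
    push_cast
    ring
  rw [h4, ← h]
  ring

theorem norm_exp_mul_I_mul (k u : ℝ) (z : ℂ) :
    ‖Complex.exp ((k * u : ℝ) * Complex.I) * z‖ = ‖z‖ := by
  rw [norm_mul, Complex.norm_exp_ofReal_mul_I, one_mul]

theorem integrable_exp_mul_I_mul {g : ℝ → ℂ} (hg : Integrable g) (k : ℝ) :
    Integrable (fun u : ℝ ↦ Complex.exp ((k * u : ℝ) * Complex.I) * g u) :=
  Integrable.bdd_mul (c := 1) hg (by exact Continuous.aestronglyMeasurable (by fun_prop))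
    (Eventually.of_forall fun _ ↦ (Complex.norm_exp_ofReal_mul_I _).le)

theorem integral_exp_mul_comp_add (g : ℝ → ℂ) (k y : ℝ) :
    ∫ u : ℝ, Complex.exp ((k * u : ℝ) * Complex.I) * g (u + y)
      = Complex.exp (-(k * y : ℝ) * Complex.I)
        * ∫ u : ℝ, Complex.exp ((k * u : ℝ) * Complex.I) * g u := by
  rw [← integral_const_mul]
  conv_rhs => rw [← integral_add_right_eq_self _ y]
  refine integral_congr_ae (Eventually.of_forall fun u ↦ ?_)
  simp only
  rw [← mul_assoc, ← Complex.exp_add]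
  congr 2
  push_cast
  ring

theorem sinh_add_div_sub (u v : ℝ) :
    Real.sinh (u + v) / (1 + Real.cosh (u + v)) - Real.sinh (u - v) / (1 + Real.cosh (u - v))
      = 2 * Real.sinh v * (Real.cosh v + Real.cosh u)⁻¹ := by
  have h1 : 1 + Real.cosh (u + v) ≠ 0 := by positivity
  have h2 : 1 + Real.cosh (u - v) ≠ 0 := by positivity
  have h3 : Real.cosh v + Real.cosh u ≠ 0 := by positivity
  field_simp
  rw [Real.sinh_add, Real.sinh_sub, Real.cosh_add, Real.cosh_sub] at *
  have hu := Real.cosh_sq u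
  have hv := Real.cosh_sq v
  generalize Real.cosh u = a at *
  generalize Real.sinh u = b at *
  generalize Real.cosh v = c at *
  generalize Real.sinh v = d at *
  grind

/-- Writes `(cosh v + cosh u)⁻¹` as an average of translates of `(1 + cosh u)⁻¹`, so that its
Fourier transform is that of the latter times the transform of an interval, `2 sin (kv) / k`. The
primitive is `sinh / (1 + cosh)`. -/
theorem integral_inv_one_add_cosh (u v : ℝ) :
    ∫ y in (-v)..v, (1 + Real.cosh (u + y))⁻¹
      = 2 * Real.sinh v * (Real.cosh v + Real.cosh u)⁻¹ := by
  have hd : ∀ y ∈ uIcc (-v) v, HasDerivAt (fun y ↦ Real.sinh (u + y) / (1 + Real.cosh (u + y)))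
      (1 + Real.cosh (u + y))⁻¹ y := by
    intro y _
    have h1 : 1 + Real.cosh (u + y) ≠ 0 := by positivity
    have hy : HasDerivAt (fun y : ℝ ↦ u + y) 1 y := (hasDerivAt_id y).const_add u
    convert! (hy.sinh.div (hy.cosh.const_add 1) h1) using 1
    have := Real.cosh_sq (u + y)
    field_simp
    linarith
  rw [intervalIntegral.integral_eq_sub_of_hasDerivAt hd, ← sinh_add_div_sub]
  · rfl
  · refine Continuous.intervalIntegrable ?_ _ _
    exact Continuous.inv₀ (by fun_prop) fun y ↦ by positivity

theorem integral_exp_neg_mul_I {k : ℝ} (hk : k ≠ 0) (v : ℝ) :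
    ∫ y in (-v)..v, Complex.exp (-(k * y : ℝ) * Complex.I) = ((2 * (Real.sin (k * v) / k) : ℝ) : ℂ) := by
  have hc : -(k : ℂ) * Complex.I ≠ 0 :=
    mul_ne_zero (neg_ne_zero.2 (by exact_mod_cast hk)) Complex.I_ne_zero
  have h1 : ∀ y : ℝ, Complex.exp (-(k * y : ℝ) * Complex.I) = Complex.exp (-(k : ℂ) * Complex.I * y) := by
    intro y
    push_cast
    ring_nf
  simp only [h1]
  have hk' : (k : ℂ) ≠ 0 := by exact_mod_cast hk
  rw [integral_exp_mul_complex hc]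
  push_cast
  rw [Complex.sin]
  have e1 : -(k : ℂ) * Complex.I * v = -(k * v) * Complex.I := by ring
  have e2 : -(k : ℂ) * Complex.I * -v = (k * v) * Complex.I := by ring
  rw [e1, e2]
  field_simp
  rw [Complex.I_sq]
  ring

/-- The Fourier transform of `(cosh v + cosh u)⁻¹`. -/
theorem fourier_inv_cosh_add_cosh {v k : ℝ} (hv : 0 < v) (hk : k ≠ 0) :
    ∫ u : ℝ, Complex.exp ((k * u : ℝ) * Complex.I) * (((Real.cosh v + Real.cosh u)⁻¹ : ℝ) : ℂ)
      = ((2 * Real.pi * (Real.sin (k * v) / (Real.sinh v * Real.sinh (Real.pi * k))) : ℝ) : ℂ) := by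
  have hs : 0 < Real.sinh v := Real.sinh_pos_iff.2 hv
  have hle : -v ≤ v := by linarith
  have hw := integrable_inv_one_add_cosh
  have hpt : ∀ u : ℝ, Complex.exp ((k * u : ℝ) * Complex.I)
      * (((Real.cosh v + Real.cosh u)⁻¹ : ℝ) : ℂ) = ((2 * Real.sinh v)⁻¹ : ℝ)
        * ∫ y in Ioc (-v) v, Complex.exp ((k * u : ℝ) * Complex.I)
          * (((1 + Real.cosh (u + y))⁻¹ : ℝ) : ℂ) := by
    intro u
    rw [integral_const_mul, integral_complex_ofReal, ← intervalIntegral.integral_of_le hle,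
      integral_inv_one_add_cosh]
    have : (Real.sinh v : ℂ) ≠ 0 := by exact_mod_cast hs.ne'
    push_cast at *
    field_simp
  simp only [hpt]
  rw [integral_const_mul, integral_integral_swap]
  · have h1 : ∀ y : ℝ, ∫ u : ℝ, Complex.exp ((k * u : ℝ) * Complex.I)
        * (((1 + Real.cosh (u + y))⁻¹ : ℝ) : ℂ) = Complex.exp (-(k * y : ℝ) * Complex.I)
          * ((2 * Real.pi * (k / Real.sinh (Real.pi * k)) : ℝ) : ℂ) := by
      intro y
      rw [← fourier_inv_one_add_cosh hk]
      exact integral_exp_mul_comp_add (fun u ↦ (((1 + Real.cosh u)⁻¹ : ℝ) : ℂ)) k y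
    simp only [h1]
    rw [integral_mul_const, ← intervalIntegral.integral_of_le hle, integral_exp_neg_mul_I hk,
      ← Complex.ofReal_mul, ← Complex.ofReal_mul, Complex.ofReal_inj]
    have hsk : Real.sinh (Real.pi * k) ≠ 0 := by
      rw [Ne, Real.sinh_eq_zero]
      exact mul_ne_zero Real.pi_ne_zero hk
    field_simp
  · have hcont : Continuous (Function.uncurry fun (u y : ℝ) ↦ Complex.exp ((k * u : ℝ) * Complex.I)
        * (((1 + Real.cosh (u + y))⁻¹ : ℝ) : ℂ)) := by
      have : Continuous (fun p : ℝ × ℝ ↦ (1 + Real.cosh (p.1 + p.2))⁻¹) :=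
        Continuous.inv₀ (by fun_prop) fun y ↦ by positivity
      simp only [Function.uncurry_def]
      fun_prop
    rw [integrable_prod_iff' hcont.aestronglyMeasurable]
    simp only [Function.uncurry_apply_pair, norm_exp_mul_I_mul]
    refine ⟨Eventually.of_forall fun y ↦ ?_, ?_⟩
    · exact integrable_exp_mul_I_mul (hw.comp_add_right y).ofReal k
    · have h2 : ∀ y : ℝ, ∫ u : ℝ, ‖(((1 + Real.cosh (u + y))⁻¹ : ℝ) : ℂ)‖
          = ∫ u : ℝ, ‖(((1 + Real.cosh u)⁻¹ : ℝ) : ℂ)‖ := fun y ↦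
        integral_add_right_eq_self (fun u : ℝ ↦ ‖(((1 + Real.cosh u)⁻¹ : ℝ) : ℂ)‖) y
      simp only [h2]
      exact integrable_const _

/-- From `sinh (πk) = 2 sinh (πk/2) cosh (πk/2)` and `|sinh y| ≥ |y|`, the function is dominated by
`π⁻¹ / cosh (πk/2)`. -/
theorem integrable_div_sinh : Integrable (fun k : ℝ ↦ k / Real.sinh (Real.pi * k)) := by
  have h1 : Integrable (fun k : ℝ ↦ (Real.cosh (Real.pi * k / 2))⁻¹) :=
    integrable_sech.comp_mul_left' Real.pi_ne_zero
  refine (h1.const_mul (Real.pi⁻¹)).mono' ?_ (Eventually.of_forall fun k ↦ ?_)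
  · exact (measurable_id.div (Real.measurable_sinh.comp (by fun_prop))).aestronglyMeasurable
  · have hc : 0 < Real.cosh (Real.pi * k / 2) := Real.cosh_pos _
    rcases eq_or_ne k 0 with rfl | hk
    · simp [Real.pi_pos.le]
    have h2 : Real.sinh (Real.pi * k)
        = 2 * Real.sinh (Real.pi * k / 2) * Real.cosh (Real.pi * k / 2) := by
      rw [← Real.sinh_two_mul]
      ring_nf
    have h3 : |Real.pi * k / 2| ≤ |Real.sinh (Real.pi * k / 2)| := by
      rw [Real.abs_sinh]
      exact Real.self_le_sinh_iff.2 (abs_nonneg _)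
    have h4 : 0 < |Real.pi * k / 2| := abs_pos.2 (by positivity)
    rw [h2, Real.norm_eq_abs, abs_div, abs_mul, abs_mul, abs_of_pos hc, abs_two, ← mul_inv,
      ← one_div, div_le_div_iff₀ (by positivity) (by positivity)]
    rw [abs_div, abs_mul, abs_of_pos Real.pi_pos, abs_two] at h3
    have h5 : Real.pi * |k| ≤ 2 * |Real.sinh (Real.pi * k / 2)| := by linarith
    nlinarith

/-- Fourier inversion applied to `fourier_inv_one_add_cosh`; the factors `2π` come from the
normalisation of `𝓕` and are removed by rescaling. -/
theorem fourier_div_sinh (x : ℝ) :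
    ∫ k : ℝ, Complex.exp ((x * k : ℝ) * Complex.I) * ((k / Real.sinh (Real.pi * k) : ℝ) : ℂ)
      = (((1 + Real.cosh x)⁻¹ : ℝ) : ℂ) := by
  set f : ℝ → ℂ := fun u ↦ (((1 + Real.cosh u)⁻¹ : ℝ) : ℂ) with hf
  have hfc : Continuous f := by
    refine Complex.continuous_ofReal.comp (Continuous.inv₀ (by fun_prop) fun y ↦ by positivity)
  have hfi : Integrable f := integrable_inv_one_add_cosh.ofReal
  have hF : ∀ ξ : ℝ, ξ ≠ 0 → 𝓕 f ξ
      = ((2 * Real.pi * (2 * Real.pi * ξ / Real.sinh (Real.pi * (2 * Real.pi * ξ))) : ℝ) : ℂ) := by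
    intro ξ hξ
    have h1 : -2 * Real.pi * ξ ≠ 0 := by
      have := Real.pi_ne_zero
      positivity
    rw [Real.fourier_real_eq_integral_exp_smul]
    have h2 := fourier_inv_one_add_cosh h1
    have h3 : -2 * Real.pi * ξ / Real.sinh (Real.pi * (-2 * Real.pi * ξ))
        = 2 * Real.pi * ξ / Real.sinh (Real.pi * (2 * Real.pi * ξ)) := by
      rw [show Real.pi * (-2 * Real.pi * ξ) = -(Real.pi * (2 * Real.pi * ξ)) by ring, Real.sinh_neg,
        show -2 * Real.pi * ξ = -(2 * Real.pi * ξ) by ring, neg_div_neg_eq]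
    rw [h3] at h2
    rw [← h2]
    refine integral_congr_ae (Eventually.of_forall fun u ↦ ?_)
    simp only [smul_eq_mul, hf]
    congr 3
    push_cast
    ring
  -- At `ξ = 0` the quotient takes the default value `0 / 0 = 0`, so the formula is only used off
  -- this point.
  have hFae : 𝓕 f =ᵐ[volume] fun ξ ↦
      ((2 * Real.pi * (2 * Real.pi * ξ / Real.sinh (Real.pi * (2 * Real.pi * ξ))) : ℝ) : ℂ) := by
    have : ∀ᵐ ξ : ℝ, ξ ≠ 0 := by simp [ae_iff]
    filter_upwards [this] with ξ hξ using hF ξ hξ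
  have hMi : Integrable (fun ξ : ℝ ↦
      ((2 * Real.pi * (2 * Real.pi * ξ / Real.sinh (Real.pi * (2 * Real.pi * ξ))) : ℝ) : ℂ)) :=
    ((integrable_div_sinh.comp_mul_left' (R := 2 * Real.pi) (by positivity)).const_mul _).ofReal
  have h4 := hfi.fourierInv_fourier_eq (hMi.congr hFae.symm) (v := x) hfc.continuousAt
  rw [Real.fourierInv_eq_fourier_neg, Real.fourier_real_eq_integral_exp_smul] at h4
  change _ = f x
  rw [← h4]
  set h : ℝ → ℂ := fun k ↦ Complex.exp ((x * k : ℝ) * Complex.I)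
    * ((k / Real.sinh (Real.pi * k) : ℝ) : ℂ) with hh
  have h5 := Measure.integral_comp_mul_left h (2 * Real.pi)
  have hpi : 0 < 2 * Real.pi := by positivity
  rw [abs_of_pos (inv_pos.2 hpi)] at h5
  have h6 : ∫ k, h k = (2 * Real.pi) • ∫ ξ, h (2 * Real.pi * ξ) := by
    rw [h5, smul_smul, mul_inv_cancel₀ hpi.ne', one_smul]
  rw [h6, ← integral_smul]
  refine integral_congr_ae ?_
  filter_upwards [hFae] with ξ hξ
  rw [hξ, hh]
  simp only [smul_eq_mul, Complex.real_smul]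
  push_cast
  rw [show (-2 * Real.pi * ξ * -x * Complex.I : ℂ) = x * (2 * Real.pi * ξ) * Complex.I by ring]
  ring

/-! ### The function `k K_{ik}(x)`: bound and Hölder continuity in `k`. -/

/-- `∫_0^∞ x sinh u e^{-x cosh u} sin (k u) du`, which equals `k K_{ik}(x)`. -/
noncomputable def sinBessel (k x : ℝ) : ℝ :=
  ∫ u in Ioi (0 : ℝ), x * Real.sinh u * Real.exp (-(x * Real.cosh u)) * Real.sin (k * u)

theorem self_le_cosh (u : ℝ) : u ≤ Real.cosh u := by
  rcases le_total u 0 with h | h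
  · exact h.trans (Real.cosh_pos u).le
  · exact (Real.self_le_sinh_iff.2 h).trans (Real.sinh_lt_cosh u).le

theorem tendsto_mul_cosh_atTop {x : ℝ} (hx : 0 < x) :
    Tendsto (fun u ↦ x * Real.cosh u) atTop atTop :=
  (tendsto_atTop_mono self_le_cosh tendsto_id).const_mul_atTop hx

theorem tendsto_exp_neg_mul_cosh {x : ℝ} (hx : 0 < x) :
    Tendsto (fun u ↦ Real.exp (-(x * Real.cosh u))) atTop (𝓝 0) :=
  Real.tendsto_exp_neg_atTop_nhds_zero.comp (tendsto_mul_cosh_atTop hx)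

theorem integrable_exp_neg_mul_cosh {x : ℝ} (hx : 0 < x) :
    Integrable (fun u ↦ Real.exp (-(x * Real.cosh u))) := by
  have h1 : Integrable (fun u : ℝ ↦ (Real.cosh u)⁻¹) := by
    refine (integrable_sech.comp_mul_left' two_ne_zero).congr (Eventually.of_forall fun u ↦ ?_)
    simp only
    rw [mul_div_cancel_left₀ u two_ne_zero]
  refine (h1.const_mul x⁻¹).mono' (by fun_prop) (Eventually.of_forall fun u ↦ ?_)
  have hc := Real.cosh_pos u
  rw [Real.norm_eq_abs, abs_of_pos (Real.exp_pos _), ← mul_inv, Real.exp_neg]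
  exact inv_anti₀ (by positivity) ((by linarith : x * Real.cosh u ≤ x * Real.cosh u + 1).trans
    (Real.add_one_le_exp _))

theorem hasDerivAt_exp_neg_mul_cosh (x u : ℝ) :
    HasDerivAt (fun u ↦ Real.exp (-(x * Real.cosh u)))
      (-(x * Real.sinh u * Real.exp (-(x * Real.cosh u)))) u := by
  convert! (((Real.hasDerivAt_cosh u).const_mul x).fun_neg).exp using 1
  ring

theorem sinh_exp_nonneg {x u : ℝ} (hx : 0 < x) (hu : 0 < u) :
    0 ≤ x * Real.sinh u * Real.exp (-(x * Real.cosh u)) := by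
  have := (Real.sinh_pos_iff.2 hu).le
  positivity

theorem integrableOn_sinh_exp {x : ℝ} (hx : 0 < x) :
    IntegrableOn (fun u ↦ x * Real.sinh u * Real.exp (-(x * Real.cosh u))) (Ioi 0) := by
  refine integrableOn_Ioi_deriv_of_nonneg' (g := fun u ↦ -Real.exp (-(x * Real.cosh u))) (l := -0)
    (fun u _ ↦ ?_) (fun u hu ↦ sinh_exp_nonneg hx hu) (tendsto_exp_neg_mul_cosh hx).neg
  simpa using (hasDerivAt_exp_neg_mul_cosh x u).fun_neg

theorem integral_sinh_exp {x : ℝ} (hx : 0 < x) :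
    ∫ u in Ioi (0 : ℝ), x * Real.sinh u * Real.exp (-(x * Real.cosh u)) = Real.exp (-x) := by
  rw [integral_Ioi_of_hasDerivAt_of_nonneg' (g := fun u ↦ -Real.exp (-(x * Real.cosh u))) (l := -0)
    (fun u _ ↦ ?_) (fun u hu ↦ sinh_exp_nonneg hx hu) (tendsto_exp_neg_mul_cosh hx).neg]
  · simp
  · simpa using (hasDerivAt_exp_neg_mul_cosh x u).fun_neg

/-- With `y = x cosh u`, `-(2 + y) e^{-y}` is a primitive in `y` of `(1 + y) e^{-y}`. The extra
weight `1 + y` is what the Hölder estimate costs. -/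
theorem hasDerivAt_two_add_mul_exp (x u : ℝ) :
    HasDerivAt (fun u ↦ -((2 + x * Real.cosh u) * Real.exp (-(x * Real.cosh u))))
      (x * Real.sinh u * Real.exp (-(x * Real.cosh u)) * (1 + x * Real.cosh u)) u := by
  convert! ((((Real.hasDerivAt_cosh u).const_mul x).const_add 2).mul
    (hasDerivAt_exp_neg_mul_cosh x u)).neg using 1
  ring

theorem tendsto_two_add_mul_exp {x : ℝ} (hx : 0 < x) :
    Tendsto (fun u ↦ -((2 + x * Real.cosh u) * Real.exp (-(x * Real.cosh u)))) atTop (𝓝 0) := by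
  have h1 : Tendsto (fun y : ℝ ↦ -((2 + y) * Real.exp (-y))) atTop (𝓝 0) := by
    have h2 := (Real.tendsto_exp_neg_atTop_nhds_zero.const_mul 2).add
      (Real.tendsto_pow_mul_exp_neg_atTop_nhds_zero 1)
    simpa [add_mul] using h2.neg
  exact h1.comp (tendsto_mul_cosh_atTop hx)

theorem integrableOn_sinh_exp_mul {x : ℝ} (hx : 0 < x) :
    IntegrableOn (fun u ↦ x * Real.sinh u * Real.exp (-(x * Real.cosh u)) * (1 + x * Real.cosh u))
      (Ioi 0) :=
  integrableOn_Ioi_deriv_of_nonneg' (fun u _ ↦ hasDerivAt_two_add_mul_exp x u)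
    (fun u hu ↦ mul_nonneg (sinh_exp_nonneg hx hu) (by positivity)) (tendsto_two_add_mul_exp hx)

theorem integral_sinh_exp_mul {x : ℝ} (hx : 0 < x) :
    ∫ u in Ioi (0 : ℝ), x * Real.sinh u * Real.exp (-(x * Real.cosh u)) * (1 + x * Real.cosh u)
      = (2 + x) * Real.exp (-x) := by
  rw [integral_Ioi_of_hasDerivAt_of_nonneg' (fun u _ ↦ hasDerivAt_two_add_mul_exp x u)
    (fun u hu ↦ mul_nonneg (sinh_exp_nonneg hx hu) (by positivity)) (tendsto_two_add_mul_exp hx)]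
  simp

theorem integrableOn_sinBessel {x : ℝ} (hx : 0 < x) (k : ℝ) :
    IntegrableOn (fun u ↦ x * Real.sinh u * Real.exp (-(x * Real.cosh u)) * Real.sin (k * u))
      (Ioi 0) :=
  Integrable.mul_bdd (c := 1) (integrableOn_sinh_exp hx)
    (by exact Continuous.aestronglyMeasurable (by fun_prop))
    (Eventually.of_forall fun u ↦ Real.abs_sin_le_one _)

theorem abs_sinBessel_le {x : ℝ} (hx : 0 < x) (k : ℝ) : |sinBessel k x| ≤ Real.exp (-x) := by
  rw [← integral_sinh_exp hx, sinBessel, ← Real.norm_eq_abs]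
  refine norm_integral_le_of_norm_le (integrableOn_sinh_exp hx) ?_
  filter_upwards [ae_restrict_mem measurableSet_Ioi] with u hu
  rw [norm_mul, Real.norm_eq_abs, abs_of_nonneg (sinh_exp_nonneg hx hu)]
  exact mul_le_of_le_one_right (sinh_exp_nonneg hx hu) (Real.abs_sin_le_one _)

/-- The difference is at most `min (|a - b|, 2)`; the two cases are `|a - b| ≤ 1` and `|a - b| ≥ 1`.
-/
theorem abs_sin_sub_sin_le_rpow (a b : ℝ) {γ : ℝ} (h0 : 0 ≤ γ) (h1 : γ ≤ 1) :
    |Real.sin a - Real.sin b| ≤ 2 * |a - b| ^ γ := by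
  have hab := abs_nonneg (a - b)
  rcases le_total |a - b| 1 with h | h
  · have e1 : |Real.sin a - Real.sin b| ≤ |a - b| := by
      have h2 := Real.sin_sub_sin a b
      rw [h2, abs_mul, abs_mul, abs_two]
      have h3 : |Real.sin ((a - b) / 2)| ≤ |(a - b) / 2| := Real.abs_sin_le_abs
      have h4 := Real.abs_cos_le_one ((a + b) / 2)
      rw [abs_div, abs_two] at h3
      nlinarith [abs_nonneg (Real.sin ((a - b) / 2)), abs_nonneg (Real.cos ((a + b) / 2))]
    have e2 : |a - b| ≤ |a - b| ^ γ := Real.self_le_rpow_of_le_one hab h h1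
    have := Real.rpow_nonneg hab γ
    linarith
  · have e1 : |Real.sin a - Real.sin b| ≤ 2 := by
      refine (abs_sub _ _).trans ?_
      linarith [Real.abs_sin_le_one a, Real.abs_sin_le_one b]
    have e2 : 1 ≤ |a - b| ^ γ := Real.one_le_rpow h h0
    linarith

/-- Take logarithms in `e^u ≤ 2 cosh u = (2/x)(x cosh u)` and use `log y ≤ y - 1`. Only the first
term is singular as `x → 0`; the second is absorbed by the exponential. -/
theorem le_log_add_mul_cosh {x : ℝ} (hx : 0 < x) (u : ℝ) :
    u ≤ max (Real.log (2 / x)) 0 + x * Real.cosh u := by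
  have hc := Real.cosh_pos u
  have h1 : Real.exp u ≤ 2 * Real.cosh u := by
    rw [Real.cosh_eq]
    linarith [Real.exp_pos (-u)]
  have h2 : u ≤ Real.log (2 * Real.cosh u) := (Real.le_log_iff_exp_le (by positivity)).2 h1
  have h3 : Real.log (2 * Real.cosh u) = Real.log (2 / x) + Real.log (x * Real.cosh u) := by
    rw [← Real.log_mul (by positivity) (by positivity)]
    congr 1
    field_simp
  have h4 := Real.log_le_sub_one_of_pos (show 0 < x * Real.cosh u by positivity)
  have h5 := le_max_left (Real.log (2 / x)) 0
  linarith

theorem rpow_le_mul_one_add {u L y γ : ℝ} (hu : 0 ≤ u) (hL : 0 ≤ L) (hy : 0 ≤ y)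
    (huLy : u ≤ L + y) (h0 : 0 ≤ γ) (h1 : γ ≤ 1) : u ^ γ ≤ (L ^ γ + 1) * (1 + y) := by
  have e1 : u ^ γ ≤ (L + y) ^ γ := Real.rpow_le_rpow hu huLy h0
  have e2 : (L + y) ^ γ ≤ L ^ γ + y ^ γ := by
    have := NNReal.rpow_add_le_add_rpow ⟨L, hL⟩ ⟨y, hy⟩ h0 h1
    exact_mod_cast this
  have e3 : y ^ γ ≤ 1 + y := by
    rcases le_total y 1 with h | h
    · linarith [Real.rpow_le_one hy h h0]
    · linarith [Real.rpow_le_self_of_one_le h h1]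
  have e4 : 0 ≤ L ^ γ := Real.rpow_nonneg hL γ
  nlinarith

/-- The Hölder bound for the sine produces `u^γ`, which `le_log_add_mul_cosh` and subadditivity of
`y ↦ y^γ` replace by a logarithm of `x` times `1 + x cosh u`. -/
theorem abs_sinBessel_sub_le {x : ℝ} (hx : 0 < x) (k k' : ℝ) {γ : ℝ} (h0 : 0 ≤ γ) (h1 : γ ≤ 1) :
    |sinBessel k x - sinBessel k' x| ≤ 2 * |k - k'| ^ γ * (max (Real.log (2 / x)) 0 ^ γ + 1)
      * ((2 + x) * Real.exp (-x)) := by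
  rw [sinBessel, sinBessel, ← integral_sub (integrableOn_sinBessel hx k) (integrableOn_sinBessel hx k'),
    ← integral_sinh_exp_mul hx, ← integral_const_mul, ← Real.norm_eq_abs]
  refine norm_integral_le_of_norm_le ((integrableOn_sinh_exp_mul hx).const_mul _) ?_
  filter_upwards [ae_restrict_mem measurableSet_Ioi] with u hu
  have hu' : 0 < u := hu
  have hs := sinh_exp_nonneg hx hu
  rw [← mul_sub, norm_mul, Real.norm_eq_abs, Real.norm_eq_abs, abs_of_nonneg hs]
  have e1 := abs_sin_sub_sin_le_rpow (k * u) (k' * u) h0 h1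
  rw [← sub_mul, abs_mul, abs_of_pos hu', Real.mul_rpow (abs_nonneg _) hu'.le] at e1
  have e2 := rpow_le_mul_one_add hu'.le (le_max_right (Real.log (2 / x)) 0)
    (show 0 ≤ x * Real.cosh u by positivity) (le_log_add_mul_cosh hx u) h0 h1
  have e3 := Real.rpow_nonneg (abs_nonneg (k - k')) γ
  calc _ ≤ x * Real.sinh u * Real.exp (-(x * Real.cosh u)) * (2 * (|k - k'| ^ γ *
        ((max (Real.log (2 / x)) 0 ^ γ + 1) * (1 + x * Real.cosh u)))) := by
        gcongr
        exact e1.trans (by gcongr)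
    _ = _ := by ring

theorem besselK_I_mul (k x : ℝ) :
    besselK (Complex.I * k) x
      = ((∫ u in Ioi (0 : ℝ), Real.exp (-(x * Real.cosh u)) * Real.cos (k * u) : ℝ) : ℂ) := by
  rw [besselK, ← integral_complex_ofReal]
  refine integral_congr_ae (Eventually.of_forall fun u ↦ ?_)
  simp only
  rw [show Complex.I * (k : ℂ) * u = (k * u : ℂ) * Complex.I by ring, Complex.cosh_mul_I]
  push_cast
  ring_nf

/-- Integration by parts: the boundary terms of `e^{-x cosh u} sin (ku)` vanish at `0` and at
infinity. -/
theorem mul_besselK_I_mul {x : ℝ} (hx : 0 < x) (k : ℝ) :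
    (k : ℂ) * besselK (Complex.I * k) x = (sinBessel k x : ℂ) := by
  rw [besselK_I_mul, ← Complex.ofReal_mul, Complex.ofReal_inj, sinBessel]
  have hE : IntegrableOn (fun u ↦ Real.exp (-(x * Real.cosh u)) * Real.cos (k * u)) (Ioi 0) :=
    Integrable.mul_bdd (c := 1) (integrable_exp_neg_mul_cosh hx).integrableOn
      (by exact Continuous.aestronglyMeasurable (by fun_prop))
      (Eventually.of_forall fun u ↦ Real.abs_cos_le_one _)
  have hd : ∀ u ∈ Ici (0 : ℝ), HasDerivAt
      (fun u ↦ Real.exp (-(x * Real.cosh u)) * Real.sin (k * u))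
      (k * (Real.exp (-(x * Real.cosh u)) * Real.cos (k * u))
        - x * Real.sinh u * Real.exp (-(x * Real.cosh u)) * Real.sin (k * u)) u := by
    intro u _
    have h1 : HasDerivAt (fun u ↦ k * u) k u := by simpa using (hasDerivAt_id u).const_mul k
    convert! (hasDerivAt_exp_neg_mul_cosh x u).mul h1.sin using 1
    ring
  have hlim : Tendsto (fun u ↦ Real.exp (-(x * Real.cosh u)) * Real.sin (k * u)) atTop (𝓝 0) := by
    refine squeeze_zero_norm (fun u ↦ ?_) (tendsto_exp_neg_mul_cosh hx)
    rw [norm_mul, Real.norm_eq_abs, abs_of_pos (Real.exp_pos _)]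
    exact mul_le_of_le_one_right (Real.exp_pos _).le (Real.abs_sin_le_one _)
  have h2 := integral_Ioi_of_hasDerivAt_of_tendsto' hd
    ((hE.const_mul k).sub (integrableOn_sinBessel hx k)) hlim
  rw [integral_sub (hE.const_mul k) (integrableOn_sinBessel hx k), integral_const_mul] at h2
  simp only [mul_zero, Real.sin_zero, sub_zero] at h2
  linarith

/-- By evenness in `u`, `K_{ik}(x)` is half the Fourier transform of `e^{-x cosh u}`; this form is
the one suited to Fubini and convolution. -/
theorem besselK_eq_half_integral {x : ℝ} (hx : 0 < x) (k : ℝ) :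
    besselK (Complex.I * k) x = (1 / 2 : ℂ) * ∫ u : ℝ, Complex.exp ((k * u : ℝ) * Complex.I)
      * (Real.exp (-(x * Real.cosh u)) : ℂ) := by
  rw [integral_real_eq_integral_Ioi_add (g := fun u : ℝ ↦ Complex.exp ((k * u : ℝ) * Complex.I)
      * (Real.exp (-(x * Real.cosh u)) : ℂ))
    (integrable_exp_mul_I_mul (integrable_exp_neg_mul_cosh hx).ofReal k), ← integral_const_mul,
    besselK_I_mul, ← integral_complex_ofReal]
  refine integral_congr_ae (Eventually.of_forall fun u ↦ ?_)
  simp only [Real.cosh_neg]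
  rw [Complex.ofReal_mul, Complex.ofReal_cos, Complex.cos]
  push_cast
  ring_nf

theorem stronglyMeasurable_sinBessel :
    StronglyMeasurable (fun p : ℝ × ℝ ↦ sinBessel p.1 p.2) := by
  have : StronglyMeasurable (Function.uncurry fun (p : ℝ × ℝ) (u : ℝ) ↦
      p.2 * Real.sinh u * Real.exp (-(p.2 * Real.cosh u)) * Real.sin (p.1 * u)) := by
    apply Continuous.stronglyMeasurable
    simp only [Function.uncurry_def]
    fun_prop
  exact this.integral_prod_right

/-! ### The Laplace transform of `K_{ik}`. -/

theorem integrableOn_exp_neg_mul {a : ℝ} (ha : 0 < a) :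
    IntegrableOn (fun t : ℝ ↦ Real.exp (-(a * t))) (Ioi 0) := by
  simpa using integrableOn_exp_mul_Ioi (a := -a) (by linarith) 0

theorem integral_exp_neg_mul {a : ℝ} (ha : 0 < a) :
    ∫ t in Ioi (0 : ℝ), Real.exp (-(a * t)) = a⁻¹ := by
  have := integral_exp_mul_Ioi (a := -a) (by linarith) 0
  simpa using this

/-- The Laplace transform of `K_{ik}`. -/
theorem laplace_besselK {v k : ℝ} (hv : 0 < v) (hk : k ≠ 0) :
    ∫ t in Ioi (0 : ℝ), (Real.exp (-(Real.cosh v * (t / 2))) : ℂ)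
      * besselK (Complex.I * k) ((t / 2 : ℝ) : ℂ)
      = ((2 * Real.pi * (Real.sin (k * v) / (Real.sinh v * Real.sinh (Real.pi * k))) : ℝ) : ℂ) := by
  have hcv := Real.cosh_pos v
  have hpt : ∀ t ∈ Ioi (0 : ℝ), (Real.exp (-(Real.cosh v * (t / 2))) : ℂ)
      * besselK (Complex.I * k) ((t / 2 : ℝ) : ℂ) = (1 / 2 : ℂ) *
        ∫ u : ℝ, Complex.exp ((k * u : ℝ) * Complex.I)
          * (Real.exp (-((Real.cosh v + Real.cosh u) / 2 * t)) : ℂ) := by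
    intro t ht
    rw [besselK_eq_half_integral (half_pos ht), mul_left_comm, ← integral_const_mul]
    congr 1
    refine integral_congr_ae (Eventually.of_forall fun u ↦ ?_)
    simp only
    rw [mul_left_comm, ← Complex.ofReal_mul, ← Real.exp_add]
    congr 4
    ring
  rw [setIntegral_congr_fun measurableSet_Ioi hpt, integral_const_mul, integral_integral_swap]
  · have h1 : ∀ u : ℝ, ∫ t in Ioi (0 : ℝ), Complex.exp ((k * u : ℝ) * Complex.I)
        * (Real.exp (-((Real.cosh v + Real.cosh u) / 2 * t)) : ℂ)
        = 2 * (Complex.exp ((k * u : ℝ) * Complex.I)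
          * (((Real.cosh v + Real.cosh u)⁻¹ : ℝ) : ℂ)) := by
      intro u
      rw [integral_const_mul, integral_complex_ofReal, integral_exp_neg_mul (by positivity)]
      push_cast
      rw [inv_div]
      ring
    simp only [h1]
    rw [integral_const_mul, fourier_inv_cosh_add_cosh hv hk]
    ring
  · have hcont : Continuous (Function.uncurry fun (t u : ℝ) ↦ Complex.exp ((k * u : ℝ) * Complex.I)
        * (Real.exp (-((Real.cosh v + Real.cosh u) / 2 * t)) : ℂ)) := by
      simp only [Function.uncurry_def]
      fun_prop
    rw [integrable_prod_iff' hcont.aestronglyMeasurable]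
    simp only [Function.uncurry_apply_pair, norm_exp_mul_I_mul]
    refine ⟨Eventually.of_forall fun u ↦ ?_, ?_⟩
    · exact ((integrableOn_exp_neg_mul (by positivity)).ofReal).const_mul _
    · have h2 : ∀ u : ℝ, ∫ t in Ioi (0 : ℝ), ‖(Real.exp (-((Real.cosh v + Real.cosh u) / 2 * t)) : ℂ)‖
          = 2 * (Real.cosh v + Real.cosh u)⁻¹ := by
        intro u
        simp only [Complex.norm_real, Real.norm_eq_abs, Real.abs_exp]
        rw [integral_exp_neg_mul (by positivity), inv_div]
        ring
      simp only [h2]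
      refine (integrable_inv_one_add_cosh.mono' ?_ (Eventually.of_forall fun u ↦ ?_)).const_mul 2
      · exact (Continuous.inv₀ (by fun_prop) fun y ↦ by positivity).aestronglyMeasurable
      · rw [Real.norm_eq_abs, abs_of_pos (by positivity)]
        exact inv_anti₀ (by positivity) (by linarith [Real.one_le_cosh v])

/-! ### Generalised eigenfunctions of the Hankel operator. -/

theorem sech_add_sech (u w : ℝ) :
    (Real.cosh ((u - w) / 2))⁻¹ + (Real.cosh ((u - -w) / 2))⁻¹
      = 2 * Real.cosh (u / 2) * Real.cosh (w / 2)
        / (Real.sinh (w / 2) ^ 2 + Real.cosh (u / 2) ^ 2) := by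
  have e1 : (u - w) / 2 = u / 2 - w / 2 := by ring
  have e2 : (u - -w) / 2 = u / 2 + w / 2 := by ring
  have h1 : 0 < Real.cosh (u / 2 - w / 2) := Real.cosh_pos _
  have h2 : 0 < Real.cosh (u / 2 + w / 2) := Real.cosh_pos _
  have h3 : 0 < Real.sinh (w / 2) ^ 2 + Real.cosh (u / 2) ^ 2 := by positivity
  have h4 : Real.cosh (u / 2 - w / 2) * Real.cosh (u / 2 + w / 2)
      = Real.sinh (w / 2) ^ 2 + Real.cosh (u / 2) ^ 2 := by
    rw [Real.cosh_sub, Real.cosh_add]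
    have hu := Real.cosh_sq (u / 2)
    have hw := Real.cosh_sq (w / 2)
    linear_combination (Real.cosh (u / 2) ^ 2) * hw - (Real.sinh (w / 2) ^ 2) * (-hu)
  have h5 : Real.cosh (u / 2 - w / 2) + Real.cosh (u / 2 + w / 2)
      = 2 * Real.cosh (u / 2) * Real.cosh (w / 2) := by
    rw [Real.cosh_sub, Real.cosh_add]
    ring
  rw [e1, e2, ← h4, ← h5]
  field_simp
  ring

/-- The substitution `t = s sinh²(w/2) / cosh²(u/2)`, Jacobian included. It is chosen so that `(t +
s)/2 + (t/2) cosh u = (s/2) cosh w`; the remaining algebraic factor splits by `sech_add_sech` into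
the values at `w` and `-w` of one function, so the half-line integral becomes one over the line. -/
theorem hStar_subst {s w : ℝ} (hs : 0 < s) (hw : 0 < w) (u : ℝ) :
    |s * (Real.sinh (w / 2) * Real.cosh (w / 2)) / Real.cosh (u / 2) ^ 2|
      • (hStar (s * Real.sinh (w / 2) ^ 2 / Real.cosh (u / 2) ^ 2 + s)
        * (s * Real.sinh (w / 2) ^ 2 / Real.cosh (u / 2) ^ 2) ^ (-(1 / 2) : ℝ)
        * Real.exp (-(s * Real.sinh (w / 2) ^ 2 / Real.cosh (u / 2) ^ 2 / 2 * Real.cosh u)))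
      = s ^ (-(1 / 2) : ℝ) * (1 / 2) * ((Real.cosh ((u - w) / 2))⁻¹ * Real.exp (-(s / 2 * Real.cosh w))
        + (Real.cosh ((u - -w) / 2))⁻¹ * Real.exp (-(s / 2 * Real.cosh (-w)))) := by
  have hσ : 0 < Real.sinh (w / 2) := Real.sinh_pos_iff.2 (by linarith)
  have hc : 0 < Real.cosh (u / 2) := Real.cosh_pos _
  have hκ : 0 < Real.cosh (w / 2) := Real.cosh_pos _
  rw [Real.cosh_neg, ← add_mul, sech_add_sech, hStar, abs_of_pos (by positivity), smul_eq_mul]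
  have hu := one_add_cosh u
  have hw1 := one_add_cosh w
  have hw2 := Real.cosh_sq (w / 2)
  have e1 : Real.exp (-(s / 2 * Real.cosh w))
      = Real.exp (-(s * Real.sinh (w / 2) ^ 2 / Real.cosh (u / 2) ^ 2 + s) / 2)
        * Real.exp (-(s * Real.sinh (w / 2) ^ 2 / Real.cosh (u / 2) ^ 2 / 2 * Real.cosh u)) := by
    rw [← Real.exp_add]
    congr 1
    have : Real.cosh u = 2 * Real.cosh (u / 2) ^ 2 - 1 := by linarith
    rw [this]
    have : Real.cosh w = 2 * Real.sinh (w / 2) ^ 2 + 1 := by linarith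
    rw [this]
    field_simp
    ring
  have e2 : ∀ y : ℝ, 0 < y → y ^ (-(1 / 2) : ℝ) = (√y)⁻¹ := by
    intro y hy
    rw [Real.rpow_neg hy.le, Real.sqrt_eq_rpow]
  have e3 : √(s * Real.sinh (w / 2) ^ 2 / Real.cosh (u / 2) ^ 2)
      = √s * Real.sinh (w / 2) / Real.cosh (u / 2) := by
    rw [Real.sqrt_div (by positivity), Real.sqrt_mul hs.le, Real.sqrt_sq hσ.le, Real.sqrt_sq hc.le]
  rw [e1, e2 _ (by positivity), e2 _ hs, e3]
  have hss : √s * √s = s := Real.mul_self_sqrt hs.le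
  have hsp : 0 < √s := Real.sqrt_pos.2 hs
  generalize Real.exp _ = A
  generalize Real.exp _ = B
  have h3 : Real.sinh (w / 2) ^ 2 + Real.cosh (u / 2) ^ 2 ≠ 0 := by positivity
  rw [show s * Real.sinh (w / 2) ^ 2 / Real.cosh (u / 2) ^ 2 + s
    = s * (Real.sinh (w / 2) ^ 2 + Real.cosh (u / 2) ^ 2) / Real.cosh (u / 2) ^ 2 by field_simp]
  field_simp

theorem integrable_sech_mul_exp {s : ℝ} (hs : 0 < s) :
    Integrable (fun p : ℝ × ℝ ↦ (Real.cosh ((p.1 - p.2) / 2))⁻¹ * Real.exp (-(s / 2 * Real.cosh p.2)))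
      := by
  have hcont : Continuous (fun p : ℝ × ℝ ↦
      (Real.cosh ((p.1 - p.2) / 2))⁻¹ * Real.exp (-(s / 2 * Real.cosh p.2))) := by
    have : Continuous (fun p : ℝ × ℝ ↦ (Real.cosh ((p.1 - p.2) / 2))⁻¹) :=
      Continuous.inv₀ (by fun_prop) fun p ↦ (Real.cosh_pos _).ne'
    fun_prop
  refine (integrable_prod_iff' hcont.aestronglyMeasurable).2 ⟨Eventually.of_forall fun w ↦ ?_, ?_⟩
  · exact (integrable_sech.comp_sub_right w).mul_const (Real.exp (-(s / 2 * Real.cosh w)))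
  · have h1 : ∀ w : ℝ, ∫ u : ℝ, ‖(Real.cosh ((u - w) / 2))⁻¹ * Real.exp (-(s / 2 * Real.cosh w))‖
        = (∫ u : ℝ, ‖(Real.cosh (u / 2))⁻¹‖) * Real.exp (-(s / 2 * Real.cosh w)) := by
      intro w
      simp only [norm_mul, Real.norm_eq_abs, Real.abs_exp]
      rw [integral_mul_const, integral_sub_right_eq_self (fun u ↦ |(Real.cosh (u / 2))⁻¹|)]
    simp only [h1]
    exact (integrable_exp_neg_mul_cosh (half_pos hs)).const_mul _

theorem integrable_sech_mul_exp_right {s : ℝ} (hs : 0 < s) (u : ℝ) :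
    Integrable (fun w ↦ (Real.cosh ((u - w) / 2))⁻¹ * Real.exp (-(s / 2 * Real.cosh w))) := by
  refine Integrable.bdd_mul (c := 1) (integrable_exp_neg_mul_cosh (half_pos hs)) ?_
    (Eventually.of_forall fun w ↦ ?_)
  · exact (Continuous.inv₀ (by fun_prop) fun p ↦ (Real.cosh_pos _).ne').aestronglyMeasurable
  · rw [Real.norm_eq_abs, abs_of_pos (inv_pos.2 (Real.cosh_pos _))]
    exact inv_le_one_of_one_le₀ (Real.one_le_cosh _)

/-- The Hankel operator acts on `t^{-1/2} e^{-(t/2) cosh u}` as convolution with `sech` in `u`. -/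
theorem hankel_exp {s : ℝ} (hs : 0 < s) (u : ℝ) :
    IntegrableOn (fun t ↦ hStar (t + s) * t ^ (-(1 / 2) : ℝ) * Real.exp (-(t / 2 * Real.cosh u)))
      (Ioi 0) ∧
    ∫ t in Ioi (0 : ℝ), hStar (t + s) * t ^ (-(1 / 2) : ℝ) * Real.exp (-(t / 2 * Real.cosh u))
      = s ^ (-(1 / 2) : ℝ) * (1 / 2) *
        ∫ w, (Real.cosh ((u - w) / 2))⁻¹ * Real.exp (-(s / 2 * Real.cosh w)) := by
  set f : ℝ → ℝ := fun w ↦ s * Real.sinh (w / 2) ^ 2 / Real.cosh (u / 2) ^ 2 with hf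
  set f' : ℝ → ℝ := fun w ↦ s * (Real.sinh (w / 2) * Real.cosh (w / 2)) / Real.cosh (u / 2) ^ 2
    with hf'
  set g : ℝ → ℝ := fun t ↦ hStar (t + s) * t ^ (-(1 / 2) : ℝ) * Real.exp (-(t / 2 * Real.cosh u))
    with hg
  have hc : 0 < Real.cosh (u / 2) := Real.cosh_pos _
  have hd : ∀ w ∈ Ioi (0 : ℝ), HasDerivWithinAt f (f' w) (Ioi 0) w := by
    intro w _
    have h1 : HasDerivAt (fun w : ℝ ↦ w / 2) (1 / 2) w := (hasDerivAt_id w).div_const 2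
    have h2 := ((h1.sinh.pow 2).const_mul s).div_const (Real.cosh (u / 2) ^ 2)
    convert! h2.hasDerivWithinAt using 1
    simp only [hf']
    push_cast
    ring
  have hmono : StrictMonoOn f (Ioi 0) := by
    intro x hx y hy hxy
    have hx' : (0 : ℝ) < x := hx
    have h1 : 0 < Real.sinh (x / 2) := Real.sinh_pos_iff.2 (by linarith)
    have h2 : Real.sinh (x / 2) < Real.sinh (y / 2) := Real.sinh_lt_sinh.2 (by linarith)
    simp only [hf]
    gcongr
  have himg : f '' Ioi 0 = Ioi 0 := by
    apply Subset.antisymm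
    · rintro _ ⟨w, hw, rfl⟩
      have hw' : (0 : ℝ) < w := hw
      have h1 : 0 < Real.sinh (w / 2) := Real.sinh_pos_iff.2 (by linarith)
      simp only [hf, mem_Ioi]
      positivity
    · intro y hy
      have hy' : (0 : ℝ) < y := hy
      -- Solution `w` of `s sinh²(w/2) / cosh²(u/2) = y`.
      refine ⟨2 * Real.arsinh (Real.cosh (u / 2) * √(y / s)), ?_, ?_⟩
      · simp only [mem_Ioi]
        have : 0 < Real.arsinh (Real.cosh (u / 2) * √(y / s)) :=
          Real.arsinh_pos_iff.2 (by positivity)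
        linarith
      · simp only [hf]
        rw [mul_div_cancel_left₀ _ two_ne_zero, Real.sinh_arsinh, mul_pow, Real.sq_sqrt (by positivity)]
        field_simp
  have e1 := integrableOn_image_iff_integrableOn_abs_deriv_smul measurableSet_Ioi hd hmono.injOn g
  have e2 := integral_image_eq_integral_abs_deriv_smul measurableSet_Ioi hd hmono.injOn g
  rw [himg] at e1 e2
  have hG := integrable_sech_mul_exp_right hs u
  have hpt : ∀ w ∈ Ioi (0 : ℝ), |f' w| • g (f w) = s ^ (-(1 / 2) : ℝ) * (1 / 2) *
      ((Real.cosh ((u - w) / 2))⁻¹ * Real.exp (-(s / 2 * Real.cosh w))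
        + (Real.cosh ((u - -w) / 2))⁻¹ * Real.exp (-(s / 2 * Real.cosh (-w)))) :=
    fun w hw ↦ hStar_subst hs hw u
  constructor
  · rw [e1]
    exact ((hG.integrableOn.add hG.comp_neg.integrableOn).const_mul _).congr
      ((ae_restrict_mem measurableSet_Ioi).mono fun w hw ↦ (hpt w hw).symm)
  · rw [e2, setIntegral_congr_fun measurableSet_Ioi hpt, integral_const_mul,
      integral_real_eq_integral_Ioi_add hG]

theorem hStar_pos {t : ℝ} (ht : 0 < t) : 0 < hStar t := div_pos (Real.exp_pos _) ht

theorem measurable_hStar : Measurable hStar :=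
  (Real.measurable_exp.comp (by fun_prop)).div measurable_id

/-- `t^{-1/2} K_{ik}(t/2)` is a generalised eigenfunction of the Hankel operator. -/
theorem hankel_besselK {s : ℝ} (hs : 0 < s) (k : ℝ) :
    ∫ t in Ioi (0 : ℝ), ((hStar (t + s) * t ^ (-(1 / 2) : ℝ) : ℝ) : ℂ)
      * besselK (Complex.I * k) ((t / 2 : ℝ) : ℂ)
      = (lam k : ℂ) * (((s ^ (-(1 / 2) : ℝ) : ℝ) : ℂ)
        * besselK (Complex.I * k) ((s / 2 : ℝ) : ℂ)) := by
  set g : ℝ → ℝ → ℝ := fun t u ↦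
    hStar (t + s) * t ^ (-(1 / 2) : ℝ) * Real.exp (-(t / 2 * Real.cosh u)) with hg
  have hpt : ∀ t ∈ Ioi (0 : ℝ), ((hStar (t + s) * t ^ (-(1 / 2) : ℝ) : ℝ) : ℂ)
      * besselK (Complex.I * k) ((t / 2 : ℝ) : ℂ)
      = (1 / 2 : ℂ) * ∫ u : ℝ, Complex.exp ((k * u : ℝ) * Complex.I) * (g t u : ℂ) := by
    intro t ht
    rw [besselK_eq_half_integral (half_pos ht), mul_left_comm, ← integral_const_mul]
    congr 1
    refine integral_congr_ae (Eventually.of_forall fun u ↦ ?_)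
    simp only [hg]
    push_cast
    ring
  have hgm : Measurable (Function.uncurry g) := by
    simp only [hg, Function.uncurry_def]
    have h1 : Measurable (fun p : ℝ × ℝ ↦ hStar (p.1 + s)) := measurable_hStar.comp (by fun_prop)
    fun_prop
  have hm : AEStronglyMeasurable (Function.uncurry fun (t u : ℝ) ↦
      Complex.exp ((k * u : ℝ) * Complex.I) * (g t u : ℂ))
      ((volume.restrict (Ioi (0 : ℝ))).prod volume) := by
    refine AEStronglyMeasurable.mul (Continuous.aestronglyMeasurable ?_)
      (Complex.measurable_ofReal.comp hgm).aestronglyMeasurable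
    fun_prop
  have hgpos : ∀ u, ∀ t ∈ Ioi (0 : ℝ), ‖((g t u : ℝ) : ℂ)‖ = g t u := by
    intro u t ht
    have ht' : (0 : ℝ) < t := ht
    have := hStar_pos (add_pos ht' hs)
    rw [Complex.norm_real, Real.norm_eq_abs, abs_of_nonneg]
    simp only [hg]
    positivity
  have hP := integrable_sech_mul_exp hs
  rw [setIntegral_congr_fun measurableSet_Ioi hpt, integral_const_mul, integral_integral_swap]
  · have h1 : ∀ u : ℝ, ∫ t in Ioi (0 : ℝ), Complex.exp ((k * u : ℝ) * Complex.I) * (g t u : ℂ)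
        = ((s ^ (-(1 / 2) : ℝ) * (1 / 2) : ℝ) : ℂ) *
          ∫ w : ℝ, Complex.exp ((k * u : ℝ) * Complex.I) *
            (((Real.cosh ((u - w) / 2))⁻¹ * Real.exp (-(s / 2 * Real.cosh w)) : ℝ) : ℂ) := by
      intro u
      rw [integral_const_mul, integral_const_mul, integral_complex_ofReal, integral_complex_ofReal,
        (hankel_exp hs u).2]
      push_cast
      ring
    simp only [h1]
    -- After the exchange of `u` and `w`, the inner integral is the Fourier transform of a
    -- translated `sech`: the translation gives `e^{ikw}` and the factor `2π / cosh (πk)`. One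
    -- factor `1/2` makes this `lam k`; the other restores `K_{ik}(s/2)`.
    rw [integral_const_mul, integral_integral_swap]
    · have h2 : ∀ w : ℝ, ∫ u : ℝ, Complex.exp ((k * u : ℝ) * Complex.I) *
            (((Real.cosh ((u - w) / 2))⁻¹ * Real.exp (-(s / 2 * Real.cosh w)) : ℝ) : ℂ)
          = ((2 * Real.pi / Real.cosh (Real.pi * k) : ℝ) : ℂ) *
            (Complex.exp ((k * w : ℝ) * Complex.I) * (Real.exp (-(s / 2 * Real.cosh w)) : ℂ)) := by
        intro w
        have h3 := integral_exp_mul_comp_add (fun u ↦ (((Real.cosh (u / 2))⁻¹ : ℝ) : ℂ)) k (-w)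
        simp only [← sub_eq_add_neg] at h3
        rw [fourier_sech] at h3
        have h4 : ∀ u : ℝ, Complex.exp ((k * u : ℝ) * Complex.I) *
            (((Real.cosh ((u - w) / 2))⁻¹ * Real.exp (-(s / 2 * Real.cosh w)) : ℝ) : ℂ)
            = Complex.exp ((k * u : ℝ) * Complex.I) * (((Real.cosh ((u - w) / 2))⁻¹ : ℝ) : ℂ)
              * (Real.exp (-(s / 2 * Real.cosh w)) : ℂ) := by
          intro u
          push_cast
          ring
        simp only [h4]
        rw [integral_mul_const, h3]
        simp only [mul_neg, Complex.ofReal_neg, neg_neg]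
        ring
      simp only [h2]
      rw [integral_const_mul, besselK_eq_half_integral (half_pos hs), lam]
      push_cast
      ring
    · exact Integrable.bdd_mul (c := 1) hP.ofReal
        (by exact Continuous.aestronglyMeasurable (by fun_prop))
        (Eventually.of_forall fun _ ↦ (Complex.norm_exp_ofReal_mul_I _).le)
  · refine (integrable_prod_iff' hm).2 ⟨Eventually.of_forall fun u ↦ ?_, ?_⟩
    · exact (Integrable.ofReal (𝕜 := ℂ) (hankel_exp hs u).1).const_mul
        (Complex.exp ((k * u : ℝ) * Complex.I))
    · simp only [Function.uncurry_apply_pair, norm_exp_mul_I_mul]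
      have h2 : ∀ u : ℝ, ∫ t in Ioi (0 : ℝ), ‖((g t u : ℝ) : ℂ)‖ = s ^ (-(1 / 2) : ℝ) * (1 / 2) *
          ∫ w, (Real.cosh ((u - w) / 2))⁻¹ * Real.exp (-(s / 2 * Real.cosh w)) := by
        intro u
        rw [setIntegral_congr_fun measurableSet_Ioi (hgpos u), (hankel_exp hs u).2]
      simp only [h2]
      exact hP.integral_prod_left.const_mul _

/-! ### The spectral variable and the kernel of `U₀`. -/

/-- The inverse of `lam` on `(0, π)`. -/
noncomputable def kappa (x : ℝ) : ℝ := Real.arcosh (Real.pi / x) / Real.pi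

theorem lam_mem {k : ℝ} (hk : 0 < k) : lam k ∈ Ioo 0 Real.pi := by
  have h1 : 1 < Real.cosh (Real.pi * k) := Real.one_lt_cosh.2 (by positivity)
  exact ⟨div_pos Real.pi_pos (Real.cosh_pos _), div_lt_self Real.pi_pos h1⟩

theorem kappa_lam {k : ℝ} (hk : 0 < k) : kappa (lam k) = k := by
  have := Real.pi_pos
  rw [kappa, lam, div_div_cancel₀ Real.pi_ne_zero, Real.arcosh_cosh (by positivity),
    mul_div_cancel_left₀ _ Real.pi_ne_zero]

theorem one_lt_pi_div {x : ℝ} (hx : x ∈ Ioo 0 Real.pi) : 1 < Real.pi / x :=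
  (one_lt_div hx.1).2 hx.2

theorem kappa_pos {x : ℝ} (hx : x ∈ Ioo 0 Real.pi) : 0 < kappa x :=
  div_pos (Real.arcosh_pos (one_lt_pi_div hx)) Real.pi_pos

theorem lam_kappa {x : ℝ} (hx : x ∈ Ioo 0 Real.pi) : lam (kappa x) = x := by
  rw [kappa, lam, mul_div_cancel₀ _ Real.pi_ne_zero, Real.cosh_arcosh (one_lt_pi_div hx).le,
    div_div_cancel₀ Real.pi_ne_zero]

theorem measurable_kappa : Measurable kappa := by
  unfold kappa Real.arcosh
  fun_prop

theorem contDiffOn_kappa : ContDiffOn ℝ 1 kappa (Ioo 0 Real.pi) := by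
  intro x hx
  refine ContDiffAt.contDiffWithinAt ?_
  refine ContDiffAt.div_const ?_ _
  exact (Real.contDiffAt_arcosh (one_lt_pi_div hx)).comp x
    (contDiffAt_const.div contDiffAt_id hx.1.ne')

theorem hasDerivAt_lam (k : ℝ) :
    HasDerivAt lam (-(Real.pi ^ 2 * Real.sinh (Real.pi * k) / Real.cosh (Real.pi * k) ^ 2)) k := by
  have h1 : HasDerivAt (fun k ↦ Real.pi * k) Real.pi k := by
    simpa using (hasDerivAt_id k).const_mul Real.pi
  convert! (hasDerivAt_const k Real.pi).div h1.cosh (Real.cosh_pos _).ne' using 1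
  ring

theorem abs_deriv_lam {k : ℝ} (hk : 0 < k) :
    |deriv lam k| = Real.pi ^ 2 * Real.sinh (Real.pi * k) / Real.cosh (Real.pi * k) ^ 2 := by
  have : 0 < Real.sinh (Real.pi * k) := Real.sinh_pos_iff.2 (by positivity)
  rw [(hasDerivAt_lam k).deriv, abs_neg, abs_of_pos (by positivity)]

theorem injOn_lam : InjOn lam (Ioi 0) := by
  intro x hx y hy h
  rw [← kappa_lam hx, h, kappa_lam hy]

theorem image_lam : lam '' Ioi 0 = Ioo 0 Real.pi := by
  apply Subset.antisymm
  · rintro _ ⟨k, hk, rfl⟩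
    exact lam_mem hk
  · intro x hx
    exact ⟨kappa x, kappa_pos hx, lam_kappa hx⟩

theorem hasDerivWithinAt_lam (k : ℝ) (_ : k ∈ Ioi (0 : ℝ)) :
    HasDerivWithinAt lam (deriv lam k) (Ioi 0) k :=
  (hasDerivAt_lam k).differentiableAt.hasDerivAt.hasDerivWithinAt

theorem integrableOn_comp_lam {E : Type*} [NormedAddCommGroup E] [NormedSpace ℝ E] (g : ℝ → E) :
    IntegrableOn g (Ioo 0 Real.pi) ↔ IntegrableOn (fun k ↦ |deriv lam k| • g (lam k)) (Ioi 0) := by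
  rw [← image_lam]
  exact integrableOn_image_iff_integrableOn_abs_deriv_smul measurableSet_Ioi hasDerivWithinAt_lam
    injOn_lam g

theorem integral_comp_lam {E : Type*} [NormedAddCommGroup E] [NormedSpace ℝ E] (g : ℝ → E) :
    ∫ x in Ioo 0 Real.pi, g x = ∫ k in Ioi (0 : ℝ), |deriv lam k| • g (lam k) := by
  rw [← image_lam]
  exact integral_image_eq_integral_abs_deriv_smul measurableSet_Ioi hasDerivWithinAt_lam
    injOn_lam g

/-- The amplitude of the kernel of `U₀`. -/
noncomputable def amp (x : ℝ) : ℝ := √(2 / kappa x) / (Real.pi * x)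

/-- The integral kernel of `U₀`. -/
noncomputable def kern (x t : ℝ) : ℝ :=
  amp x * (t ^ (-(1 / 2) : ℝ) * sinBessel (kappa x) (t / 2))

theorem amp_pos {x : ℝ} (hx : x ∈ Ioo 0 Real.pi) : 0 < amp x := by
  have h1 := kappa_pos hx
  have h2 := hx.1
  have := Real.pi_pos
  unfold amp
  positivity

theorem contDiffOn_amp : ContDiffOn ℝ 1 amp (Ioo 0 Real.pi) := by
  refine ContDiffOn.div (ContDiffOn.sqrt (contDiffOn_const.div contDiffOn_kappa fun x hx ↦
    (kappa_pos hx).ne') fun x hx ↦ (div_pos two_pos (kappa_pos hx)).ne')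
    (contDiffOn_const.mul contDiffOn_id) fun x hx ↦ (mul_pos Real.pi_pos hx.1).ne'

theorem measurable_amp : Measurable amp := by
  have := measurable_kappa
  unfold amp
  fun_prop

theorem measurable_kern : Measurable (fun p : ℝ × ℝ ↦ kern p.1 p.2) := by
  have h1 := measurable_kappa
  have h2 := measurable_amp
  have h3 : Measurable (fun p : ℝ × ℝ ↦ sinBessel (kappa p.1) (p.2 / 2)) :=
    stronglyMeasurable_sinBessel.measurable.comp
      ((h1.comp measurable_fst).prodMk (measurable_snd.div_const 2))
  unfold kern
  fun_prop

theorem abs_kern_le {x t : ℝ} (hx : x ∈ Ioo 0 Real.pi) (ht : 0 < t) :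
    |kern x t| ≤ amp x * (t ^ (-(1 / 2) : ℝ) * Real.exp (-(t / 2))) := by
  have h1 := amp_pos hx
  have h2 : 0 < t ^ (-(1 / 2) : ℝ) := Real.rpow_pos_of_pos ht _
  rw [kern, abs_mul, abs_mul, abs_of_pos h1, abs_of_pos h2]
  have := abs_sinBessel_le (half_pos ht) (kappa x)
  gcongr

/-- The constants combine to `√(2/k) cosh (πk) / π²`, which is `amp` at `lam k`: one factor `1/k` is
spent on writing `K_{ik}` as `sinBessel k / k`. -/
theorem psi_eq_kern {k t : ℝ} (hk : 0 < k) (ht : 0 < t) :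
    ((|deriv lam k| ^ (-(1 / 2) : ℝ) : ℝ) : ℂ) * psi k t = (kern (lam k) t : ℂ) := by
  have hpi := Real.pi_pos
  have hs : 0 < Real.sinh (Real.pi * k) := Real.sinh_pos_iff.2 (by positivity)
  have hc : 0 < Real.cosh (Real.pi * k) := Real.cosh_pos _
  have hk' : (k : ℂ) ≠ 0 := by exact_mod_cast hk.ne'
  have h1 : besselK (Complex.I * k) ((t / 2 : ℝ) : ℂ) = ((sinBessel k (t / 2) / k : ℝ) : ℂ) := by
    rw [Complex.ofReal_div (sinBessel k (t / 2)) k, ← mul_besselK_I_mul (half_pos ht),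
      mul_div_cancel_left₀ _ hk']
  rw [psi, h1, kern, amp, kappa_lam hk, ← Complex.ofReal_mul, ← Complex.ofReal_mul,
    Complex.ofReal_inj, abs_deriv_lam hk, lam, Real.rpow_neg (by positivity), ← Real.sqrt_eq_rpow,
    Real.sqrt_div (by positivity), Real.sqrt_mul (by positivity), Real.sqrt_sq hpi.le,
    Real.sqrt_sq hc.le, Real.sqrt_mul (by positivity), Real.sqrt_mul zero_le_two,
    Real.sqrt_div zero_le_two]
  have hss := Real.sqrt_pos.2 hs
  have hkk := Real.sqrt_pos.2 hk
  have h2 := Real.mul_self_sqrt hk.le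
  generalize sinBessel k (t / 2) = S
  generalize t ^ (-(1 / 2) : ℝ) = R
  field_simp
  rw [Real.sq_sqrt hk.le]

/-! ### The two total families and the unitary operator. -/

/-- The common factor of the transforms of `t^{1/2} e^{-(t/2) cosh v}`, `v > 0`. -/
noncomputable def sineWeight (x : ℝ) : ℝ := amp x * (kappa x / Real.sinh (Real.pi * kappa x))

/-- The function `t^{1/2} e^{-(t/2) cosh v}`. -/
noncomputable def expVec (v t : ℝ) : ℝ := t ^ (1 / 2 : ℝ) * Real.exp (-(Real.cosh v * (t / 2)))

/-- The transform of `expVec v`. -/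
noncomputable def sineVec (v x : ℝ) : ℝ :=
  2 * Real.pi / Real.sinh v * (sineWeight x * Real.sin (kappa x * v))

theorem integral_expVec_mul_kern {v x : ℝ} (hv : 0 < v) (hx : x ∈ Ioo 0 Real.pi) :
    ∫ t in Ioi (0 : ℝ), (expVec v t : ℂ) * (kern x t : ℂ) = (sineVec v x : ℂ) := by
  have hk := kappa_pos hx
  have hpt : ∀ t ∈ Ioi (0 : ℝ), (expVec v t : ℂ) * (kern x t : ℂ)
      = ((amp x * kappa x : ℝ) : ℂ) * ((Real.exp (-(Real.cosh v * (t / 2))) : ℂ)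
      * besselK (Complex.I * kappa x) ((t / 2 : ℝ) : ℂ)) := by
    intro t ht
    have ht' : (0 : ℝ) < t := ht
    have h1 : ((t ^ (1 / 2 : ℝ) : ℝ) : ℂ) * ((t ^ (-(1 / 2) : ℝ) : ℝ) : ℂ) = 1 := by
      rw [← Complex.ofReal_mul, ← Real.rpow_add ht']
      simp
    rw [expVec, kern]
    push_cast [← mul_besselK_I_mul (half_pos ht')]
    linear_combination (amp x * kappa x * Complex.exp (-(Complex.cosh v * (t / 2)))
      * besselK (Complex.I * kappa x) (t / 2)) * h1
  rw [setIntegral_congr_fun measurableSet_Ioi hpt, integral_const_mul, laplace_besselK hv hk.ne',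
    ← Complex.ofReal_mul, Complex.ofReal_inj, sineVec, sineWeight]
  have hs : 0 < Real.sinh (Real.pi * kappa x) := Real.sinh_pos_iff.2 (mul_pos Real.pi_pos hk)
  have hsv : 0 < Real.sinh v := Real.sinh_pos_iff.2 hv
  field_simp

/-- In the variable `k` the sine family becomes plain sines with respect to the density `k / sinh
(πk)`, whose cosine transform is known. -/
theorem abs_deriv_lam_mul_sineWeight_sq {k : ℝ} (hk : 0 < k) :
    |deriv lam k| * sineWeight (lam k) ^ 2 = 2 / Real.pi ^ 2 * (k / Real.sinh (Real.pi * k)) := by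
  have hpi := Real.pi_pos
  have hs : 0 < Real.sinh (Real.pi * k) := Real.sinh_pos_iff.2 (by positivity)
  have hc : 0 < Real.cosh (Real.pi * k) := Real.cosh_pos _
  rw [abs_deriv_lam hk, sineWeight, amp, kappa_lam hk, mul_pow, div_pow, Real.sq_sqrt (by positivity),
    lam]
  field_simp

theorem measurable_sineWeight : Measurable sineWeight := by
  have h1 := measurable_kappa
  have h2 := measurable_amp
  have h3 : Measurable (fun x ↦ Real.sinh (Real.pi * kappa x)) :=
    Real.measurable_sinh.comp (by fun_prop)
  unfold sineWeight
  fun_prop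

theorem memLp_sineWeight : MemLp sineWeight 2 (volume.restrict (Ioo 0 Real.pi)) := by
  rw [memLp_two_iff_integrable_sq measurable_sineWeight.aestronglyMeasurable]
  refine (integrableOn_comp_lam _).2 ?_
  refine (integrable_div_sinh.integrableOn.const_mul (2 / Real.pi ^ 2)).congr ?_
  filter_upwards [ae_restrict_mem measurableSet_Ioi] with k hk
  rw [smul_eq_mul, abs_deriv_lam_mul_sineWeight_sq hk]

theorem memLp_sineVec (v : ℝ) :
    MemLp (fun x ↦ (sineVec v x : ℂ)) 2 (volume.restrict (Ioo 0 Real.pi)) := by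
  refine MemLp.ofReal ?_
  refine MemLp.const_mul ?_ _
  refine memLp_sineWeight.of_le (measurable_sineWeight.mul (Real.measurable_sin.comp
    (measurable_kappa.mul_const v))).aestronglyMeasurable (Eventually.of_forall fun x ↦ ?_)
  rw [norm_mul]
  exact mul_le_of_le_one_right (norm_nonneg _) (Real.abs_sin_le_one _)

theorem measurable_expVec (v : ℝ) : Measurable (expVec v) := by
  unfold expVec
  fun_prop

theorem expVec_mul_expVec {t : ℝ} (ht : 0 < t) (v w : ℝ) : expVec v t * expVec w t
    = t ^ ((2 : ℝ) - 1) * Real.exp (-((Real.cosh v + Real.cosh w) / 2 * t)) := by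
  have h1 : t ^ (1 / 2 : ℝ) * t ^ (1 / 2 : ℝ) = t ^ ((2 : ℝ) - 1) := by
    rw [← Real.rpow_add ht]
    norm_num
  rw [expVec, expVec, ← h1,
    show -((Real.cosh v + Real.cosh w) / 2 * t)
      = -(Real.cosh v * (t / 2)) + -(Real.cosh w * (t / 2)) by ring, Real.exp_add]
  ring

theorem memLp_expVec (v : ℝ) :
    MemLp (fun t ↦ (expVec v t : ℂ)) 2 (volume.restrict (Ioi (0 : ℝ))) := by
  refine MemLp.ofReal (f := expVec v) ?_
  rw [memLp_two_iff_integrable_sq (measurable_expVec v).aestronglyMeasurable]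
  have h1 := integrableOn_rpow_mul_exp_neg_mul_rpow (p := 1) (s := 2 - 1) (b := Real.cosh v)
    (by norm_num) one_pos (Real.cosh_pos v)
  refine h1.congr ?_
  filter_upwards [ae_restrict_mem measurableSet_Ioi] with t ht
  rw [sq, expVec_mul_expVec ht, Real.rpow_one]
  ring_nf

theorem inner_toLp_ofReal {s : Set ℝ} {f : ℝ → ℝ}
    (hf : MemLp (fun x ↦ (f x : ℂ)) 2 (volume.restrict s)) (g : L2 s) :
    inner ℂ (hf.toLp _) g = ∫ x in s, (f x : ℂ) * g x := by
  rw [L2.inner_def]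
  refine integral_congr_ae ?_
  filter_upwards [hf.coeFn_toLp] with x hx
  rw [hx, RCLike.inner_apply, Complex.conj_ofReal, mul_comm]

theorem inner_expVec (v w : ℝ) :
    inner ℂ ((memLp_expVec v).toLp _) ((memLp_expVec w).toLp _)
      = ((4 / (Real.cosh v + Real.cosh w) ^ 2 : ℝ) : ℂ) := by
  rw [inner_toLp_ofReal]
  have h1 : ∀ᵐ t ∂volume.restrict (Ioi (0 : ℝ)),
      (expVec v t : ℂ) * ((memLp_expVec w).toLp _ : L2 (Ioi 0)) t
      = ((t ^ ((2 : ℝ) - 1) * Real.exp (-((Real.cosh v + Real.cosh w) / 2 * t)) : ℝ) : ℂ) := by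
    filter_upwards [(memLp_expVec w).coeFn_toLp, ae_restrict_mem measurableSet_Ioi] with t h ht
    rw [h, ← Complex.ofReal_mul, expVec_mul_expVec ht]
  rw [integral_congr_ae h1, integral_complex_ofReal,
    Real.integral_rpow_mul_exp_neg_mul_Ioi two_pos (by positivity), Real.Gamma_two]
  have : 0 < Real.cosh v + Real.cosh w := by positivity
  rw [Real.rpow_two]
  congr 1
  field_simp
  norm_num

theorem integral_cos_mul_div_sinh (x : ℝ) :
    ∫ k in Ioi (0 : ℝ), Real.cos (x * k) * (k / Real.sinh (Real.pi * k))
      = (1 / 2) * (1 + Real.cosh x)⁻¹ := by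
  have h1 := fourier_div_sinh x
  rw [integral_real_eq_integral_Ioi_add (g := fun k : ℝ ↦ Complex.exp ((x * k : ℝ) * Complex.I)
    * ((k / Real.sinh (Real.pi * k) : ℝ) : ℂ))
    (integrable_exp_mul_I_mul integrable_div_sinh.ofReal x)] at h1
  have h2 : ∀ k : ℝ, Complex.exp ((x * k : ℝ) * Complex.I) * ((k / Real.sinh (Real.pi * k) : ℝ) : ℂ)
      + Complex.exp ((x * -k : ℝ) * Complex.I) * ((-k / Real.sinh (Real.pi * -k) : ℝ) : ℂ)
      = ((2 * (Real.cos (x * k) * (k / Real.sinh (Real.pi * k))) : ℝ) : ℂ) := by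
    intro k
    rw [mul_neg Real.pi, Real.sinh_neg, neg_div_neg_eq, ← add_mul]
    push_cast
    rw [Complex.cos]
    ring_nf
  simp only [h2] at h1
  rw [integral_complex_ofReal, Complex.ofReal_inj, integral_const_mul] at h1
  linarith

/-- Product-to-sum reduces to `integral_cos_mul_div_sinh` at `v ± w`; the two results combine
through `(1 + cosh (v - w))(1 + cosh (v + w)) = (cosh v + cosh w)²`. -/
theorem integral_sin_mul_sin {v w : ℝ} :
    ∫ k in Ioi (0 : ℝ), (k / Real.sinh (Real.pi * k)) * (Real.sin (k * v) * Real.sin (k * w))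
      = (1 / 2) * (Real.sinh v * Real.sinh w / (Real.cosh v + Real.cosh w) ^ 2) := by
  have hi : ∀ x : ℝ, IntegrableOn (fun k ↦ Real.cos (x * k) * (k / Real.sinh (Real.pi * k))) (Ioi 0) :=
    fun x ↦ Integrable.bdd_mul (c := 1) integrable_div_sinh.integrableOn
      (by exact Continuous.aestronglyMeasurable (by fun_prop))
      (Eventually.of_forall fun k ↦ Real.abs_cos_le_one _)
  have h1 : ∀ k : ℝ, (k / Real.sinh (Real.pi * k)) * (Real.sin (k * v) * Real.sin (k * w))
      = (1 / 2) * (Real.cos ((v - w) * k) * (k / Real.sinh (Real.pi * k))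
        - Real.cos ((v + w) * k) * (k / Real.sinh (Real.pi * k))) := by
    intro k
    rw [show (v - w) * k = k * v - k * w by ring, show (v + w) * k = k * v + k * w by ring,
      Real.cos_sub, Real.cos_add]
    ring
  simp only [h1]
  rw [integral_const_mul, integral_sub (hi _) (hi _), integral_cos_mul_div_sinh,
    integral_cos_mul_div_sinh]
  have h3 : 0 < 1 + Real.cosh (v - w) := by positivity
  have h4 : 0 < 1 + Real.cosh (v + w) := by positivity
  have h5 : (1 + Real.cosh (v - w)) * (1 + Real.cosh (v + w))
      = (Real.cosh v + Real.cosh w) ^ 2 := by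
    rw [Real.cosh_sub, Real.cosh_add]
    have hv := Real.cosh_sq v
    have hw := Real.cosh_sq w
    linear_combination (-(Real.sinh w) ^ 2) * (-hv) + (-1 + Real.cosh v ^ 2) * hw
  have h6 : Real.cosh (v + w) - Real.cosh (v - w) = 2 * (Real.sinh v * Real.sinh w) := by
    rw [Real.cosh_sub, Real.cosh_add]
    ring
  rw [← h5]
  field_simp
  linarith

theorem inner_sineVec {v w : ℝ} (hv : 0 < v) (hw : 0 < w) :
    inner ℂ ((memLp_sineVec v).toLp _) ((memLp_sineVec w).toLp _)
      = ((4 / (Real.cosh v + Real.cosh w) ^ 2 : ℝ) : ℂ) := by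
  rw [inner_toLp_ofReal]
  have h1 : ∀ᵐ x ∂volume.restrict (Ioo 0 Real.pi),
      (sineVec v x : ℂ) * ((memLp_sineVec w).toLp _ : L2 (Ioo 0 Real.pi)) x
      = ((sineVec v x * sineVec w x : ℝ) : ℂ) := by
    filter_upwards [(memLp_sineVec w).coeFn_toLp] with t h
    rw [h, ← Complex.ofReal_mul]
  rw [integral_congr_ae h1, integral_complex_ofReal, integral_comp_lam, Complex.ofReal_inj]
  have hsv : 0 < Real.sinh v := Real.sinh_pos_iff.2 hv
  have hsw : 0 < Real.sinh w := Real.sinh_pos_iff.2 hw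
  have hpi := Real.pi_pos
  have h2 : ∀ k ∈ Ioi (0 : ℝ), |deriv lam k| • (sineVec v (lam k) * sineVec w (lam k))
      = 8 / (Real.sinh v * Real.sinh w) *
        ((k / Real.sinh (Real.pi * k)) * (Real.sin (k * v) * Real.sin (k * w))) := by
    intro k hk
    have h3 := abs_deriv_lam_mul_sineWeight_sq hk
    rw [sineVec, sineVec, kappa_lam hk, smul_eq_mul]
    calc _ = (|deriv lam k| * sineWeight (lam k) ^ 2) * (2 * Real.pi) ^ 2
          / (Real.sinh v * Real.sinh w) * (Real.sin (k * v) * Real.sin (k * w)) := by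
          field_simp
      _ = _ := by
          rw [h3]
          field_simp
          ring
  rw [setIntegral_congr_fun measurableSet_Ioi h2, integral_const_mul, integral_sin_mul_sin]
  have : 0 < Real.cosh v + Real.cosh w := by positivity
  field_simp
  norm_num

/-- The functions `expVec v`, `v > 0`, separate. -/
theorem ae_eq_zero_of_integral_expVec_mul {g : ℝ → ℂ}
    (hg : IntegrableOn (fun t ↦ ((t ^ (1 / 2 : ℝ) * Real.exp (-t) : ℝ) : ℂ) * g t) (Ioi 0))
    (h : ∀ v : ℝ, 0 < v → ∫ t in Ioi (0 : ℝ), (expVec v t : ℂ) * g t = 0) :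
    ∀ᵐ t ∂volume.restrict (Ioi (0 : ℝ)), g t = 0 := by
  have h1 := ae_eq_zero_of_laplace_eq_zero hg fun n ↦ by
    have hn : (1 : ℝ) < 2 + 2 * n := by
      have : (0 : ℝ) ≤ n := n.cast_nonneg
      linarith
    -- At `cosh v = 2 + 2n` the exponential is `e^{-t} e^{-nt}`, so the hypothesis covers all
    -- integer Laplace moments of `t^{1/2} e^{-t} g`. Already `n = 0` gives `cosh v > 1`, hence `v >
    -- 0`.
    rw [← h (Real.arcosh (2 + 2 * n)) (Real.arcosh_pos hn)]
    refine integral_congr_ae (Eventually.of_forall fun t ↦ ?_)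
    simp only [expVec]
    rw [Real.cosh_arcosh hn.le, show -((2 + 2 * (n : ℝ)) * (t / 2)) = -t + -(n * t) by ring,
      Real.exp_add]
    push_cast
    ring
  filter_upwards [h1, ae_restrict_mem measurableSet_Ioi] with t ht ht'
  have h2 : ((t ^ (1 / 2 : ℝ) * Real.exp (-t) : ℝ) : ℂ) ≠ 0 := by
    have : 0 < t ^ (1 / 2 : ℝ) := Real.rpow_pos_of_pos ht' _
    exact_mod_cast (by positivity : 0 < t ^ (1 / 2 : ℝ) * Real.exp (-t)).ne'
  exact (mul_eq_zero.1 ht).resolve_left h2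

theorem memLp_rpow_mul_exp :
    MemLp (fun t ↦ ((t ^ (1 / 2 : ℝ) * Real.exp (-t) : ℝ) : ℂ)) 2
      (volume.restrict (Ioi (0 : ℝ))) := by
  have h := memLp_expVec (Real.arcosh 2)
  refine h.congr_norm (by fun_prop) (Eventually.of_forall fun t ↦ ?_)
  rw [expVec, Real.cosh_arcosh one_le_two, show (2 : ℝ) * (t / 2) = t by ring]

theorem expVec_total (g : L2 (Ioi 0))
    (h : ∀ v : Ioi (0 : ℝ), inner ℂ ((memLp_expVec (v : ℝ)).toLp _) g = 0) : g = 0 := by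
  have hg := Lp.memLp g
  have h1 := ae_eq_zero_of_integral_expVec_mul (g := g) (memLp_rpow_mul_exp.integrable_mul hg)
    fun v hv ↦ by rw [← inner_toLp_ofReal (memLp_expVec v)]; exact h ⟨v, hv⟩
  exact (Lp.eq_zero_iff_ae_eq_zero).2 h1

theorem sineVec_total (g : L2 (Ioo 0 Real.pi))
    (h : ∀ v : Ioi (0 : ℝ), inner ℂ ((memLp_sineVec (v : ℝ)).toLp _) g = 0) : g = 0 := by
  have hmg : IntegrableOn (fun x ↦ (sineWeight x : ℂ) * g x) (Ioo 0 Real.pi) :=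
    MemLp.integrable_mul memLp_sineWeight.ofReal (Lp.memLp g)
  have h1 := ae_eq_zero_of_sine_transform_eq_zero ((integrableOn_comp_lam _).1 hmg) fun v hv ↦ by
    have hsv : (Real.sinh v : ℂ) ≠ 0 := by exact_mod_cast (Real.sinh_pos_iff.2 hv).ne'
    have hpi : (Real.pi : ℂ) ≠ 0 := by exact_mod_cast Real.pi_ne_zero
    have h2 := h ⟨v, hv⟩
    rw [inner_toLp_ofReal, integral_comp_lam] at h2
    have h3 : ∀ k ∈ Ioi (0 : ℝ), |deriv lam k| • ((sineVec v (lam k) : ℂ) * g (lam k))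
        = (2 * Real.pi / Real.sinh v : ℂ) *
          (|deriv lam k| • ((sineWeight (lam k) : ℂ) * g (lam k)) * (Real.sin (k * v) : ℂ)) := by
      intro k hk
      rw [sineVec, kappa_lam hk, Complex.real_smul, Complex.real_smul]
      push_cast
      ring
    rw [setIntegral_congr_fun measurableSet_Ioi h3, integral_const_mul] at h2
    refine (mul_eq_zero.1 h2).resolve_left ?_
    exact div_ne_zero (mul_ne_zero two_ne_zero hpi) hsv
  -- Vanishing for almost every `k` is carried back to almost every `x` by the change of variables
  -- in the integral of the norm.
  have h4 : ∫ x in Ioo 0 Real.pi, ‖(sineWeight x : ℂ) * g x‖ = 0 := by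
    rw [integral_comp_lam]
    refine integral_eq_zero_of_ae ?_
    filter_upwards [h1] with k hk
    have h5 := congrArg norm hk
    rwa [norm_smul, norm_zero, norm_abs_eq_norm, Real.norm_eq_abs] at h5
  rw [integral_eq_zero_iff_of_nonneg (fun _ ↦ norm_nonneg _) hmg.norm] at h4
  refine (Lp.eq_zero_iff_ae_eq_zero).2 ?_
  filter_upwards [h4, ae_restrict_mem measurableSet_Ioo] with x hx hx'
  have hk := kappa_pos hx'
  have hs : 0 < Real.sinh (Real.pi * kappa x) := Real.sinh_pos_iff.2 (mul_pos Real.pi_pos hk)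
  have hw : sineWeight x ≠ 0 := (mul_pos (amp_pos hx') (div_pos hk hs)).ne'
  exact (mul_eq_zero.1 (norm_eq_zero.1 hx)).resolve_left (by exact_mod_cast hw)

/-- The action on the family `expVec` is all that is recorded about `U`; by totality it determines
`U`, and every later property is derived from it. -/
theorem exists_unitary : ∃ U : L2 (Ioi 0) ≃ₗᵢ[ℂ] L2 (Ioo 0 Real.pi),
    ∀ v : ℝ, 0 < v → U ((memLp_expVec v).toLp _) = (memLp_sineVec v).toLp _ := by
  obtain ⟨U, hU⟩ := exists_linearIsometryEquiv_of_inner_eq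
    (fun v : Ioi (0 : ℝ) ↦ (memLp_expVec (v : ℝ)).toLp _)
    (fun v : Ioi (0 : ℝ) ↦ (memLp_sineVec (v : ℝ)).toLp _)
    (fun v w ↦ by rw [inner_expVec, inner_sineVec v.2 w.2]) expVec_total sineVec_total
  exact ⟨U, fun v hv ↦ hU ⟨v, hv⟩⟩

/-! ### The unitary as an integral operator. -/

/-- Functions with equal integrals over the measurable subsets of all compact subintervals of an
open set agree almost everywhere on it. -/
theorem ae_eq_of_forall_setIntegral_Icc_eq {f g : ℝ → ℂ} {s : Set ℝ} (hs : IsOpen s)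
    (h : ∀ a b, Icc a b ⊆ s → IntegrableOn f (Icc a b) ∧ IntegrableOn g (Icc a b) ∧
      ∀ S ⊆ Icc a b, MeasurableSet S → ∫ x in S, f x = ∫ x in S, g x) :
    ∀ᵐ x ∂volume.restrict s, f x = g x := by
  -- Countably many rational intervals contained in `s` cover it, so the exceptional null sets can
  -- be united.
  have hsub : s ⊆ ⋃ p : ℚ × ℚ, {x | x ∈ Icc (p.1 : ℝ) p.2 ∧ Icc (p.1 : ℝ) p.2 ⊆ s} := by
    intro x hx
    obtain ⟨ε, hε, hball⟩ := Metric.isOpen_iff.1 hs x hx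
    obtain ⟨p, hp1, hp2⟩ := exists_rat_btwn (show x - ε < x by linarith)
    obtain ⟨r, hr1, hr2⟩ := exists_rat_btwn (show x < x + ε by linarith)
    refine mem_iUnion.2 ⟨(p, r), ⟨hp2.le, hr1.le⟩, fun y hy ↦ hball ?_⟩
    rw [Real.ball_eq_Ioo]
    exact ⟨hp1.trans_le hy.1, hy.2.trans_lt hr2⟩
  refine ae_restrict_of_ae_restrict_of_subset hsub ((ae_restrict_iUnion_iff _ _).2 fun p ↦ ?_)
  by_cases hp : Icc (p.1 : ℝ) p.2 ⊆ s
  · obtain ⟨hf, hg, hfg⟩ := h _ _ hp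
    refine ae_restrict_of_ae_restrict_of_subset (t := Icc (p.1 : ℝ) p.2) (fun x hx ↦ hx.1) ?_
    refine Integrable.ae_eq_of_forall_setIntegral_eq f g hf hg fun S hS _ ↦ ?_
    rw [Measure.restrict_restrict hS]
    exact hfg _ inter_subset_right (hS.inter measurableSet_Icc)
  · simp [hp]

theorem measure_ne_top_of_subset_Icc {S : Set ℝ} {a b : ℝ} (hS : S ⊆ Icc a b) :
    volume S ≠ ⊤ :=
  ((measure_mono hS).trans_lt (by simp)).ne

theorem exists_amp_le {a b : ℝ} (hab : Icc a b ⊆ Ioo 0 Real.pi) :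
    ∃ M, ∀ x ∈ Icc a b, amp x ≤ M := by
  obtain ⟨M, hM⟩ := isCompact_Icc.exists_bound_of_continuousOn (contDiffOn_amp.continuousOn.mono hab)
  exact ⟨M, fun x hx ↦ (le_abs_self _).trans (hM x hx)⟩

/-- The weight controlling the kernel of `U₀`. -/
noncomputable def kernWeight (t : ℝ) : ℝ := t ^ (-(1 / 2) : ℝ) * Real.exp (-(t / 2))

theorem kernWeight_pos {t : ℝ} (ht : 0 < t) : 0 < kernWeight t :=
  mul_pos (Real.rpow_pos_of_pos ht _) (Real.exp_pos _)

theorem measurable_kernWeight : Measurable kernWeight := by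
  unfold kernWeight
  fun_prop

theorem integrableOn_kernWeight : IntegrableOn kernWeight (Ioi 0) := by
  have h := integrableOn_rpow_mul_exp_neg_mul_rpow (p := 1) (s := -(1 / 2)) (b := 1 / 2)
    (by norm_num) one_pos (by norm_num)
  refine h.congr (Eventually.of_forall fun t ↦ ?_)
  simp only [kernWeight, Real.rpow_one]
  ring_nf

/-- The Fubini hypothesis: on a compact subinterval of `(0, π)` the kernel is dominated by a
constant times `kernWeight t`, and `S` has finite measure. -/
theorem integrable_mul_kern {a b : ℝ} (hab : Icc a b ⊆ Ioo 0 Real.pi) {S : Set ℝ}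
    (hS : S ⊆ Icc a b) (hSm : MeasurableSet S) {φ : ℝ → ℂ}
    (hφm : AEStronglyMeasurable φ (volume.restrict (Ioi 0)))
    (hφ : IntegrableOn (fun t ↦ (kernWeight t : ℂ) * φ t) (Ioi 0)) :
    Integrable (Function.uncurry fun (x t : ℝ) ↦ φ t * (kern x t : ℂ))
      ((volume.restrict S).prod (volume.restrict (Ioi 0))) := by
  obtain ⟨M, hM⟩ := exists_amp_le hab
  have : IsFiniteMeasure (volume.restrict S) :=
    ⟨by simpa using (measure_ne_top_of_subset_Icc hS).lt_top⟩
  have h1 : Integrable (fun p : ℝ × ℝ ↦ M * ‖(kernWeight p.2 : ℂ) * φ p.2‖)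
      ((volume.restrict S).prod (volume.restrict (Ioi 0))) :=
    (integrable_const M).mul_prod hφ.norm
  refine h1.mono' ?_ ?_
  · exact (hφm.comp_snd).mul (Complex.measurable_ofReal.comp measurable_kern).aestronglyMeasurable
  · rw [Measure.prod_restrict]
    filter_upwards [ae_restrict_mem (hSm.prod measurableSet_Ioi)] with p hp
    have hp2 : 0 < p.2 := hp.2
    have h2 := abs_kern_le (hab (hS hp.1)) hp2
    have h3 := hM _ (hS hp.1)
    have h4 := kernWeight_pos hp2
    rw [Function.uncurry_def, norm_mul, norm_mul, Complex.norm_real, Complex.norm_real,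
      Real.norm_eq_abs, Real.norm_eq_abs, abs_of_pos h4]
    calc ‖φ p.2‖ * |kern p.1 p.2| ≤ ‖φ p.2‖ * (M * kernWeight p.2) := by
          refine mul_le_mul_of_nonneg_left (h2.trans ?_) (norm_nonneg _)
          exact mul_le_mul_of_nonneg_right h3 h4.le
      _ = _ := by ring

theorem setIntegral_eq_inner {s S : Set ℝ} (hSs : S ⊆ s) (hS : MeasurableSet S)
    (hfin : volume.restrict s S ≠ ⊤) (f : L2 s) :
    ∫ x in S, f x = inner ℂ (indicatorConstLp 2 hS hfin (1 : ℂ)) f := by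
  rw [L2.inner_indicatorConstLp_one, Measure.restrict_restrict_of_subset hSs]

theorem restrict_ne_top {s S : Set ℝ} {a b : ℝ} (hS : S ⊆ Icc a b) : volume.restrict s S ≠ ⊤ :=
  ((Measure.restrict_apply_le _ _).trans_lt (measure_ne_top_of_subset_Icc hS).lt_top).ne

variable {U : L2 (Ioi 0) ≃ₗᵢ[ℂ] L2 (Ioo 0 Real.pi)}

theorem inner_unitary_right (x : L2 (Ioo 0 Real.pi)) (y : L2 (Ioi 0)) :
    inner ℂ x (U y) = inner ℂ (U.symm x) y := by
  rw [← U.inner_map_map (U.symm x) y, U.apply_symm_apply]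

/-- The adjoint of `U` on indicators of sets in compact subintervals of `(0, π)`. -/
theorem symm_indicator_ae_eq
    (hU : ∀ v : ℝ, 0 < v → U ((memLp_expVec v).toLp _) = (memLp_sineVec v).toLp _)
    {a b : ℝ} (hab : Icc a b ⊆ Ioo 0 Real.pi) {S : Set ℝ} (hS : S ⊆ Icc a b)
    (hSm : MeasurableSet S) :
    ∀ᵐ t ∂volume.restrict (Ioi (0 : ℝ)),
      U.symm (indicatorConstLp 2 hSm (restrict_ne_top hS) (1 : ℂ)) t
        = ((∫ x in S, kern x t : ℝ) : ℂ) := by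
  set w := U.symm (indicatorConstLp 2 hSm (restrict_ne_top hS) (1 : ℂ)) with hw
  have hint : ∀ c : ℝ → ℝ, Measurable c →
      IntegrableOn (fun t ↦ kernWeight t * c t) (Ioi 0) →
      Integrable (Function.uncurry fun (x t : ℝ) ↦ (c t : ℂ) * (kern x t : ℂ))
      ((volume.restrict S).prod (volume.restrict (Ioi 0))) := by
    intro c hc hci
    refine integrable_mul_kern hab hS hSm (Complex.measurable_ofReal.comp hc).aestronglyMeasurable ?_
    refine (Integrable.ofReal (𝕜 := ℂ) hci).congr (Eventually.of_forall fun t ↦ ?_)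
    simp
  have hweight : ∀ r : ℝ, 0 ≤ r → IntegrableOn
      (fun t ↦ kernWeight t * (t ^ (1 / 2 : ℝ) * Real.exp (-(r * t)))) (Ioi 0) := by
    intro r hr
    refine (integrableOn_exp_neg_mul (show 0 < r + 1 / 2 by linarith)).congr ?_
    filter_upwards [ae_restrict_mem measurableSet_Ioi] with t ht
    have ht' : (0 : ℝ) < t := ht
    have h1 : t ^ (-(1 / 2) : ℝ) * t ^ (1 / 2 : ℝ) = 1 := by
      rw [← Real.rpow_add ht']
      simp
    rw [kernWeight, show -((r + 1 / 2) * t) = -(t / 2) + -(r * t) by ring, Real.exp_add]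
    linear_combination (-Real.exp (-(t / 2)) * Real.exp (-(r * t))) * h1
  have hswap : ∀ c : ℝ → ℝ, ∀ t, ∫ x in S, (c t : ℂ) * (kern x t : ℂ)
      = (c t : ℂ) * ((∫ x in S, kern x t : ℝ) : ℂ) := by
    intro c t
    rw [integral_const_mul, integral_complex_ofReal]
  have hp : IntegrableOn (fun t ↦ ((t ^ (1 / 2 : ℝ) * Real.exp (-t) : ℝ) : ℂ)
      * ((∫ x in S, kern x t : ℝ) : ℂ)) (Ioi 0) := by
    have h1 := (hint (fun t ↦ t ^ (1 / 2 : ℝ) * Real.exp (-t)) (by fun_prop)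
      (by simpa using hweight 1 zero_le_one)).integral_prod_right
    simp only [Function.uncurry_apply_pair] at h1
    simp only [hswap (fun t ↦ t ^ (1 / 2 : ℝ) * Real.exp (-t))] at h1
    exact h1
  have hww := memLp_rpow_mul_exp.integrable_mul (Lp.memLp w)
  -- Both sides have the same pairing with every `expVec v`: unitarity turns the left one into the
  -- integral of `sineVec v` over `S`, and Fubini with `integral_expVec_mul_kern` does the same for
  -- the right one.
  have hzero := ae_eq_zero_of_integral_expVec_mul (g := fun t ↦ w t - ((∫ x in S, kern x t : ℝ) : ℂ))
    (by
      refine (hww.sub hp).congr (Eventually.of_forall fun t ↦ ?_)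
      simp only [Pi.sub_apply, Pi.mul_apply]
      ring)
    (fun v hv ↦ by
      have hi := hint (expVec v) (measurable_expVec v) (by
        have := hweight (Real.cosh v / 2) (by positivity)
        refine this.congr (Eventually.of_forall fun t ↦ ?_)
        simp only [expVec]
        ring_nf)
      have h1 : ∫ t in Ioi (0 : ℝ), (expVec v t : ℂ) * w t
          = ∫ x in S, (sineVec v x : ℂ) := by
        rw [← inner_toLp_ofReal (memLp_expVec v), hw, ← U.inner_map_eq_flip, hU v hv]
        rw [← inner_conj_symm, L2.inner_indicatorConstLp_one,
          Measure.restrict_restrict_of_subset (hS.trans hab)]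
        have h2 : ∀ᵐ x ∂volume.restrict S, ((memLp_sineVec v).toLp _ : L2 (Ioo 0 Real.pi)) x
            = (sineVec v x : ℂ) :=
          ae_restrict_of_ae_restrict_of_subset (hS.trans hab) (memLp_sineVec v).coeFn_toLp
        rw [integral_congr_ae h2, integral_complex_ofReal, Complex.conj_ofReal]
      have h3 : ∫ x in S, (sineVec v x : ℂ)
          = ∫ t in Ioi (0 : ℝ), (expVec v t : ℂ) * ((∫ x in S, kern x t : ℝ) : ℂ) := by
        rw [← setIntegral_congr_fun hSm fun x hx ↦ integral_expVec_mul_kern hv (hab (hS hx)),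
          integral_integral_swap hi]
        simp only [hswap]
      have h4 := hi.integral_prod_right
      simp only [Function.uncurry_apply_pair, hswap] at h4
      have h5 : IntegrableOn (fun t ↦ (expVec v t : ℂ) * w t) (Ioi 0) :=
        (memLp_expVec v).integrable_mul (Lp.memLp w)
      simp only [mul_sub]
      rw [integral_sub h5 h4, h1, h3, sub_self])
  filter_upwards [hzero] with t ht
  exact sub_eq_zero.1 ht

/-- `U` acts as the integral operator with kernel `kern`. -/
theorem ae_eq_integral_kern
    (hU : ∀ v : ℝ, 0 < v → U ((memLp_expVec v).toLp _) = (memLp_sineVec v).toLp _)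
    (φ : L2 (Ioi 0)) (hφ : IntegrableOn (fun t ↦ (kernWeight t : ℂ) * φ t) (Ioi 0)) :
    ∀ᵐ x ∂volume.restrict (Ioo 0 Real.pi), U φ x = ∫ t in Ioi (0 : ℝ), φ t * (kern x t : ℂ) := by
  refine ae_eq_of_forall_setIntegral_Icc_eq isOpen_Ioo fun a b hab ↦ ⟨?_, ?_, fun S hS hSm ↦ ?_⟩
  · have h1 : MemLp (U φ) 2 (volume.restrict (Icc a b)) :=
      (Lp.memLp (U φ)).mono_measure (Measure.restrict_mono hab le_rfl)
    exact h1.integrable one_le_two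
  · exact (integrable_mul_kern hab subset_rfl measurableSet_Icc (Lp.aestronglyMeasurable φ)
      hφ).integral_prod_left
  · have h1 := integrable_mul_kern hab hS hSm (Lp.aestronglyMeasurable φ) hφ
    -- The integral of `U φ` over `S` is the inner product of `U* 1_S` with `φ`, and `U* 1_S` is
    -- known from `symm_indicator_ae_eq`.
    rw [integral_integral_swap h1,
      setIntegral_eq_inner (hS.trans hab) hSm (restrict_ne_top hS),
      inner_unitary_right, L2.inner_def]
    refine integral_congr_ae ?_
    filter_upwards [symm_indicator_ae_eq hU hab hS hSm] with t ht
    rw [ht, RCLike.inner_apply, Complex.conj_ofReal, integral_const_mul, integral_complex_ofReal]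

theorem extendsTransform
    (hU : ∀ v : ℝ, 0 < v → U ((memLp_expVec v).toLp _) = (memLp_sineVec v).toLp _) :
    ExtendsTransform U := by
  intro φ hφ
  have hφ1 := hφ.memLp.coeFn_toLp
  have hi : IntegrableOn (fun t ↦ (kernWeight t : ℂ) * φ t) (Ioi 0) := by
    obtain ⟨C, hC⟩ := hφ.smooth.continuous.bounded_above_of_compact_support hφ.compact
    exact Integrable.mul_bdd (c := C) (Integrable.ofReal (𝕜 := ℂ) integrableOn_kernWeight)
      hφ.smooth.continuous.aestronglyMeasurable (Eventually.of_forall hC)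
  have h1 := ae_eq_integral_kern hU (hφ.memLp.toLp φ) (hi.congr (by
    filter_upwards [hφ1] with t ht
    rw [ht]))
  filter_upwards [h1] with x hx k hk hkx
  rw [hx, transformU, ← integral_const_mul]
  refine integral_congr_ae ?_
  filter_upwards [hφ1, ae_restrict_mem measurableSet_Ioi] with t ht ht'
  rw [ht, ← hkx, ← psi_eq_kern hk ht']
  ring

/-! ### The Hankel operator. -/

/-- The image of the indicator of `S` under the Hankel operator. -/
noncomputable def hankelIndicator (S : Set ℝ) (t : ℝ) : ℝ := ∫ s in S, hStar (t + s)

theorem measurable_hStar_add : Measurable (fun p : ℝ × ℝ ↦ hStar (p.1 + p.2)) :=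
  measurable_hStar.comp (by fun_prop)

theorem measurable_hankelIndicator (S : Set ℝ) : Measurable (hankelIndicator S) :=
  (StronglyMeasurable.integral_prod_right (ν := volume.restrict S)
    (f := fun t s ↦ hStar (t + s)) measurable_hStar_add.stronglyMeasurable).measurable

theorem abs_hStar_add_le {a s t : ℝ} (ha : 0 < a) (hs : a ≤ s) (ht : 0 < t) :
    |hStar (t + s)| ≤ a⁻¹ * Real.exp (-(t / 2)) := by
  have h1 := hStar_pos (show 0 < t + s by linarith)
  rw [abs_of_pos h1, hStar, div_eq_inv_mul]
  gcongr
  · linarith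
  · linarith

theorem pos_of_Icc_subset {a b : ℝ} (hab : Icc a b ⊆ Ioi 0) (h : (Icc a b).Nonempty) : 0 < a :=
  hab (left_mem_Icc.2 (nonempty_Icc.1 h))

theorem exists_bound_hStar_add {a b : ℝ} (hab : Icc a b ⊆ Ioi 0) :
    ∃ C, ∀ s ∈ Icc a b, ∀ t, 0 < t → |hStar (t + s)| ≤ C * Real.exp (-(t / 2)) := by
  refine ⟨a⁻¹, fun s hs t ht ↦ abs_hStar_add_le ?_ hs.1 ht⟩
  exact pos_of_Icc_subset hab ⟨s, hs⟩

theorem memLp_exp : MemLp (fun t : ℝ ↦ Real.exp (-(t / 2))) 2 (volume.restrict (Ioi 0)) := by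
  rw [memLp_two_iff_integrable_sq (by fun_prop)]
  refine (integrableOn_exp_neg_mul one_pos).congr (Eventually.of_forall fun t ↦ ?_)
  simp only
  rw [← Real.exp_nat_mul]
  ring_nf

theorem integrable_hStar_mul {a b : ℝ} (hab : Icc a b ⊆ Ioi 0) {S : Set ℝ} (hS : S ⊆ Icc a b)
    (hSm : MeasurableSet S) {f : ℝ → ℂ} (hfm : AEStronglyMeasurable f (volume.restrict (Ioi 0)))
    (hf : IntegrableOn (fun t ↦ Real.exp (-(t / 2)) * ‖f t‖) (Ioi 0)) :
    Integrable (Function.uncurry fun (t s : ℝ) ↦ (hStar (t + s) : ℂ) * f t)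
      ((volume.restrict (Ioi 0)).prod (volume.restrict S)) := by
  obtain ⟨C, hC⟩ := exists_bound_hStar_add hab
  have : IsFiniteMeasure (volume.restrict S) :=
    ⟨by simpa using (measure_ne_top_of_subset_Icc hS).lt_top⟩
  have h1 : Integrable (fun p : ℝ × ℝ ↦ (Real.exp (-(p.1 / 2)) * ‖f p.1‖) * C)
      ((volume.restrict (Ioi 0)).prod (volume.restrict S)) :=
    Integrable.mul_prod hf (integrable_const C)
  refine h1.mono' ?_ ?_
  · exact (Complex.measurable_ofReal.comp measurable_hStar_add).aestronglyMeasurable.mul hfm.comp_fst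
  · rw [Measure.prod_restrict]
    filter_upwards [ae_restrict_mem (measurableSet_Ioi.prod hSm)] with p hp
    have h2 := hC _ (hS hp.2) p.1 hp.1
    rw [Function.uncurry_def, norm_mul, Complex.norm_real, Real.norm_eq_abs]
    calc |hStar (p.1 + p.2)| * ‖f p.1‖ ≤ (C * Real.exp (-(p.1 / 2))) * ‖f p.1‖ := by gcongr
      _ = _ := by ring

theorem exists_bound_hankelIndicator {a b : ℝ} (hab : Icc a b ⊆ Ioi 0) {S : Set ℝ}
    (hS : S ⊆ Icc a b) :
    ∃ C, ∀ t, 0 < t → |hankelIndicator S t| ≤ C * Real.exp (-(t / 2)) := by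
  obtain ⟨C, hC⟩ := exists_bound_hStar_add hab
  refine ⟨C * volume.real S, fun t ht ↦ ?_⟩
  have h1 := norm_setIntegral_le_of_norm_le_const (μ := volume) (s := S)
    (f := fun s ↦ hStar (t + s)) (measure_ne_top_of_subset_Icc hS).lt_top
    (C := C * Real.exp (-(t / 2))) fun s hs ↦ hC s (hS hs) t ht
  rw [Real.norm_eq_abs] at h1
  rw [hankelIndicator]
  linarith

theorem memLp_hankelIndicator {a b : ℝ} (hab : Icc a b ⊆ Ioi 0) {S : Set ℝ}
    (hS : S ⊆ Icc a b) :
    MemLp (fun t ↦ (hankelIndicator S t : ℂ)) 2 (volume.restrict (Ioi 0)) := by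
  obtain ⟨C, hC⟩ := exists_bound_hankelIndicator hab hS
  refine MemLp.ofReal (MemLp.of_le (memLp_exp.const_mul C)
    (measurable_hankelIndicator S).aestronglyMeasurable ?_)
  filter_upwards [ae_restrict_mem measurableSet_Ioi] with t ht
  exact (hC t ht).trans (le_abs_self _)

/-- Fubini moves the Hankel kernel onto `kern x`, which is an eigenfunction with eigenvalue `lam
(kappa x) = x`. -/
theorem integral_hankelIndicator_mul_kern {a b : ℝ} (hab : Icc a b ⊆ Ioi 0) {S : Set ℝ}
    (hS : S ⊆ Icc a b) (hSm : MeasurableSet S) {x : ℝ} (hx : x ∈ Ioo 0 Real.pi) :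
    ∫ t in Ioi (0 : ℝ), (hankelIndicator S t : ℂ) * (kern x t : ℂ)
      = (x : ℂ) * ∫ s in S, (kern x s : ℂ) := by
  have hkm : Measurable (kern x) := Measurable.of_uncurry_left (f := kern) measurable_kern
  have hi : IntegrableOn (fun t ↦ Real.exp (-(t / 2)) * ‖(kern x t : ℂ)‖) (Ioi 0) := by
    refine (integrableOn_kernWeight.const_mul (amp x)).mono' ?_ ?_
    · fun_prop
    · filter_upwards [ae_restrict_mem measurableSet_Ioi] with t ht
      have ht' : (0 : ℝ) < t := ht
      rw [Complex.norm_real, norm_mul, norm_norm, Real.norm_eq_abs, Real.norm_eq_abs, Real.abs_exp]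
      refine (mul_le_of_le_one_left (abs_nonneg _) ?_).trans (abs_kern_le hx ht)
      exact Real.exp_le_one_iff.2 (by linarith)
  have h1 := integrable_hStar_mul hab hS hSm (f := fun t ↦ (kern x t : ℂ))
    (Complex.measurable_ofReal.comp hkm).aestronglyMeasurable hi
  have h2 : ∀ t, (hankelIndicator S t : ℂ) * (kern x t : ℂ)
      = ∫ s in S, (hStar (t + s) : ℂ) * (kern x t : ℂ) := by
    intro t
    rw [integral_mul_const, integral_complex_ofReal, hankelIndicator]
  simp only [h2]
  rw [integral_integral_swap h1, ← integral_const_mul]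
  refine setIntegral_congr_fun hSm fun s hs ↦ ?_
  have hs' : 0 < s := hab (hS hs)
  have h3 : ∀ t ∈ Ioi (0 : ℝ), (hStar (t + s) : ℂ) * (kern x t : ℂ)
      = ((amp x * kappa x : ℝ) : ℂ) * (((hStar (t + s) * t ^ (-(1 / 2) : ℝ) : ℝ) : ℂ)
      * besselK (Complex.I * kappa x) ((t / 2 : ℝ) : ℂ)) := by
    intro t ht
    rw [kern]
    push_cast [← mul_besselK_I_mul (half_pos ht)]
    ring
  rw [setIntegral_congr_fun measurableSet_Ioi h3, integral_const_mul, hankel_besselK hs',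
    lam_kappa hx, kern]
  push_cast [← mul_besselK_I_mul (half_pos hs')]
  ring

/-- The Hankel operator, defined by its diagonalisation. -/
noncomputable def hankelOp (U : L2 (Ioi 0) ≃ₗᵢ[ℂ] L2 (Ioo 0 Real.pi)) :
    L2 (Ioi 0) →L[ℂ] L2 (Ioi 0) :=
  (U.symm.toContinuousLinearEquiv : L2 (Ioo 0 Real.pi) →L[ℂ] L2 (Ioi 0)).comp
    ((mulOp (fun x : ℝ ↦ (x : ℂ)) memLp_id).comp
      (U.toContinuousLinearEquiv : L2 (Ioi 0) →L[ℂ] L2 (Ioo 0 Real.pi)))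

theorem hankelOp_apply (f : L2 (Ioi 0)) :
    hankelOp U f = U.symm (mulOp (fun x : ℝ ↦ (x : ℂ)) memLp_id (U f)) := rfl

theorem inner_mulOp_id (f g : L2 (Ioo 0 Real.pi)) :
    inner ℂ (mulOp (fun x : ℝ ↦ (x : ℂ)) memLp_id f) g
      = inner ℂ f (mulOp (fun x : ℝ ↦ (x : ℂ)) memLp_id g) := by
  rw [L2.inner_def, L2.inner_def]
  refine integral_congr_ae ?_
  filter_upwards [mulOp_coeFn (fun x : ℝ ↦ (x : ℂ)) memLp_id f,
    mulOp_coeFn (fun x : ℝ ↦ (x : ℂ)) memLp_id g] with x h1 h2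
  rw [h1, h2, RCLike.inner_apply, RCLike.inner_apply, map_mul, Complex.conj_ofReal]
  ring

theorem hankelOp_indicator
    (hU : ∀ v : ℝ, 0 < v → U ((memLp_expVec v).toLp _) = (memLp_sineVec v).toLp _)
    {a b : ℝ} (hab : Icc a b ⊆ Ioi 0) {S : Set ℝ} (hS : S ⊆ Icc a b) (hSm : MeasurableSet S) :
    hankelOp U (indicatorConstLp 2 hSm (restrict_ne_top hS) (1 : ℂ))
      = (memLp_hankelIndicator hab hS).toLp _ := by
  -- Compare the images under `U`, where both sides are given by the kernel and the eigenvalue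
  -- equation applies.
  rw [hankelOp_apply, LinearIsometryEquiv.symm_apply_eq]
  set χ : L2 (Ioi 0) := indicatorConstLp 2 hSm (restrict_ne_top hS) (1 : ℂ) with hχ
  have hχ1 : ∀ᵐ t ∂volume.restrict (Ioi (0 : ℝ)), χ t = S.indicator (fun _ ↦ (1 : ℂ)) t :=
    indicatorConstLp_coeFn
  have h1 := ae_eq_integral_kern hU χ (by
    have h2 : IntegrableOn (fun t ↦ S.indicator (fun t ↦ (kernWeight t : ℂ)) t) (Ioi 0) :=
      (Integrable.ofReal (𝕜 := ℂ) integrableOn_kernWeight).indicator hSm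
    refine h2.congr ?_
    filter_upwards [hχ1] with t ht
    rw [ht]
    by_cases h : t ∈ S <;> simp [h])
  have hB := (memLp_hankelIndicator hab hS).coeFn_toLp
  have h2 := ae_eq_integral_kern hU ((memLp_hankelIndicator hab hS).toLp _) (by
    obtain ⟨C, hC⟩ := exists_bound_hankelIndicator hab hS
    have h3 : IntegrableOn (fun t ↦ (kernWeight t : ℂ) * (hankelIndicator S t : ℂ)) (Ioi 0) := by
      refine Integrable.mul_bdd (c := C) (Integrable.ofReal (𝕜 := ℂ) integrableOn_kernWeight)
        (Complex.measurable_ofReal.comp (measurable_hankelIndicator S)).aestronglyMeasurable ?_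
      filter_upwards [ae_restrict_mem measurableSet_Ioi] with t ht
      have ht' : (0 : ℝ) < t := ht
      rw [Complex.norm_real, Real.norm_eq_abs]
      have h4 := hC t ht
      have h5 : Real.exp (-(t / 2)) ≤ 1 := Real.exp_le_one_iff.2 (by linarith)
      have h6 : 0 ≤ C := by
        by_contra h7
        push Not at h7
        linarith [abs_nonneg (hankelIndicator S t), mul_neg_of_neg_of_pos h7 (Real.exp_pos (-(t / 2)))]
      exact h4.trans (mul_le_of_le_one_right h6 h5)
    refine h3.congr ?_
    filter_upwards [hB] with t ht
    rw [ht])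
  refine Lp.ext ?_
  filter_upwards [h1, h2, mulOp_coeFn (fun x : ℝ ↦ (x : ℂ)) memLp_id (U χ),
    ae_restrict_mem measurableSet_Ioo] with x h3 h4 h5 hx
  rw [h5, h4, h3]
  have e1 : ∫ t in Ioi (0 : ℝ), ((memLp_hankelIndicator hab hS).toLp _ : L2 (Ioi 0)) t
      * (kern x t : ℂ) = ∫ t in Ioi (0 : ℝ), (hankelIndicator S t : ℂ) * (kern x t : ℂ) := by
    refine integral_congr_ae ?_
    filter_upwards [hB] with t ht
    rw [ht]
  have e2 : ∫ t in Ioi (0 : ℝ), χ t * (kern x t : ℂ) = ∫ s in S, (kern x s : ℂ) := by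
    rw [← Measure.restrict_restrict_of_subset (hS.trans hab), ← integral_indicator hSm]
    refine integral_congr_ae ?_
    filter_upwards [hχ1] with t ht
    rw [ht]
    by_cases h : t ∈ S <;> simp [h]
  rw [e1, e2, integral_hankelIndicator_mul_kern hab hS hSm hx]

theorem diagonalises_hankelOp : Diagonalises U (hankelOp U) := by
  intro g
  rw [hankelOp_apply, U.apply_symm_apply, U.apply_symm_apply]

theorem integrableOn_exp_mul_norm (f : L2 (Ioi 0)) :
    IntegrableOn (fun t ↦ Real.exp (-(t / 2)) * ‖f t‖) (Ioi 0) :=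
  memLp_exp.integrable_mul (Lp.memLp f).norm

theorem isHankel_hankelOp
    (hU : ∀ v : ℝ, 0 < v → U ((memLp_expVec v).toLp _) = (memLp_sineVec v).toLp _) :
    IsHankel hStar (hankelOp U) := by
  intro f
  have hf := integrableOn_exp_mul_norm f
  have hfm := Lp.aestronglyMeasurable f
  have h1 : ∀ t ∈ Ioi (0 : ℝ), IntegrableOn (fun s ↦ (hStar (t + s) : ℂ) * f s) (Ioi 0) := by
    intro t ht
    refine (hf.const_mul t⁻¹).mono' ?_ ?_
    · exact (Complex.measurable_ofReal.comp (measurable_hStar.comp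
        (by fun_prop))).aestronglyMeasurable.mul hfm
    · filter_upwards [ae_restrict_mem measurableSet_Ioi] with s hs
      have h2 := abs_hStar_add_le ht le_rfl hs
      rw [norm_mul, Complex.norm_real, Real.norm_eq_abs, add_comm, ← mul_assoc]
      gcongr
  have h2 : ∀ᵐ t ∂volume.restrict (Ioi (0 : ℝ)),
      hankelOp U f t = ∫ s in Ioi (0 : ℝ), (hStar (t + s) : ℂ) * f s := by
    -- Duality: the integral of `H f` over `S` is the inner product of `H 1_S` with `f`, since
    -- multiplication by `λ` is symmetric. Thus the formula on indicators suffices.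
    refine ae_eq_of_forall_setIntegral_Icc_eq isOpen_Ioi fun a b hab ↦ ⟨?_, ?_, fun S hS hSm ↦ ?_⟩
    · have h1 : MemLp (hankelOp U f) 2 (volume.restrict (Icc a b)) :=
        (Lp.memLp (hankelOp U f)).mono_measure (Measure.restrict_mono hab le_rfl)
      exact h1.integrable one_le_two
    · have h3 := (integrable_hStar_mul hab subset_rfl measurableSet_Icc hfm hf).integral_prod_right
      simp only [Function.uncurry_apply_pair] at h3
      simp only [add_comm] at h3 ⊢
      exact h3
    · have h3 := integrable_hStar_mul hab hS hSm hfm hf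
      have e1 := integral_integral_swap h3
      simp only [integral_mul_const, integral_complex_ofReal] at e1
      rw [setIntegral_eq_inner (hS.trans hab) hSm (restrict_ne_top hS), hankelOp_apply,
        ← LinearIsometryEquiv.inner_map_eq_flip, ← inner_mulOp_id,
        inner_unitary_right, ← hankelOp_apply,
        hankelOp_indicator hU hab hS hSm, inner_toLp_ofReal]
      simp only [add_comm] at e1 ⊢
      rw [← e1]
      simp only [hankelIndicator]
  filter_upwards [h2, ae_restrict_mem measurableSet_Ioi] with t ht ht'
  exact ⟨h1 t ht', ht⟩

/-! ### The logarithmic weight and the dominating function. -/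

theorem q_pos {t : ℝ} (ht : 0 < t) : 0 < q t := by
  unfold q
  have h2 : 0 < Real.log 2 := Real.log_pos (by norm_num)
  split_ifs with h
  · exact inv_pos.2 (abs_pos.2 (Real.log_neg ht (by linarith)).ne)
  · exact inv_pos.2 h2

/-- The logarithm is `2 log 2 - log t`. For `t < 1/2` one has `log 2 ≤ |log t|`, and for `t ≥ 1/2`
one has `-log t ≤ log 2`; both cases give the constant `3`. -/
theorem max_log_le_inv_q {t : ℝ} (ht : 0 < t) : max (Real.log (2 / (t / 2))) 0 ≤ 3 * (q t)⁻¹ := by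
  have h2 : 0 < Real.log 2 := Real.log_pos (by norm_num)
  have hq := q_pos ht
  refine max_le ?_ (by positivity)
  have h1 : Real.log (2 / (t / 2)) = 2 * Real.log 2 - Real.log t := by
    rw [show 2 / (t / 2) = 2 ^ 2 / t by ring, Real.log_div (by norm_num) ht.ne', Real.log_pow]
    push_cast
    ring
  have h3 : Real.log (1 / 2) = -Real.log 2 := by rw [one_div, Real.log_inv]
  rw [h1, q]
  split_ifs with h
  · have h4 := Real.log_le_log ht h.le
    rw [inv_inv, abs_of_neg (Real.log_neg ht (by linarith))]
    linarith
  · have h4 := Real.log_le_log (by norm_num) (not_lt.1 h)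
    rw [inv_inv]
    linarith

theorem one_le_two_mul_inv_q {t : ℝ} (ht : 0 < t) : 1 ≤ 2 * (q t)⁻¹ := by
  have h2 : 1 / 2 < Real.log 2 := by linarith [Real.log_two_gt_d9]
  have h3 := inv_anti₀ (q_pos ht) (q_le ht)
  rw [inv_inv] at h3
  linarith

theorem max_log_rpow_add_one_le {t γ : ℝ} (ht : 0 < t) (h0 : 0 ≤ γ) :
    max (Real.log (2 / (t / 2))) 0 ^ γ + 1 ≤ (3 ^ γ + 2 ^ γ) * q t ^ (-γ) := by
  have hq := q_pos ht
  have e1 := Real.rpow_le_rpow (le_max_right _ 0) (max_log_le_inv_q ht) h0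
  have e2 := Real.rpow_le_rpow zero_le_one (one_le_two_mul_inv_q ht) h0
  rw [Real.mul_rpow (by norm_num) (by positivity), Real.inv_rpow hq.le, ← Real.rpow_neg hq.le] at e1 e2
  rw [Real.one_rpow] at e2
  linarith

/-- Under `t = e^{-u}` this is the integrability of `u^{-r}` on `(log 2, ∞)`. -/
theorem integrableOn_inv_mul_abs_log_rpow {r : ℝ} (hr : 1 < r) :
    IntegrableOn (fun t ↦ t⁻¹ * |Real.log t| ^ (-r)) (Ioo 0 (1 / 2)) := by
  have himg : (fun u : ℝ ↦ Real.exp (-u)) '' Ioi (Real.log 2) = Ioo 0 (1 / 2) := by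
    apply Subset.antisymm
    · rintro _ ⟨u, hu, rfl⟩
      refine ⟨Real.exp_pos _, ?_⟩
      have := Real.exp_lt_exp.2 (neg_lt_neg (mem_Ioi.1 hu))
      rwa [Real.exp_neg, Real.exp_neg, Real.exp_log two_pos, ← one_div, ← one_div, one_div,
        ← Real.exp_neg] at this
    · intro y hy
      refine ⟨-Real.log y, ?_, by simp [Real.exp_log hy.1]⟩
      have := Real.log_lt_log hy.1 hy.2
      rw [one_div, Real.log_inv] at this
      simp only [mem_Ioi]
      linarith
  have hd : ∀ u ∈ Ioi (Real.log 2), HasDerivWithinAt (fun u : ℝ ↦ Real.exp (-u)) (-Real.exp (-u))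
      (Ioi (Real.log 2)) u := by
    intro u _
    simpa using ((hasDerivAt_id u).fun_neg.exp).hasDerivWithinAt
  have hinj : InjOn (fun u : ℝ ↦ Real.exp (-u)) (Ioi (Real.log 2)) := by
    intro x _ y _ h
    exact neg_injective (Real.exp_injective h)
  have h2 : 0 < Real.log 2 := Real.log_pos (by norm_num)
  rw [← himg, integrableOn_image_iff_integrableOn_abs_deriv_smul measurableSet_Ioi hd hinj]
  refine (integrableOn_Ioi_rpow_of_lt (a := -r) (by linarith) h2).congr ?_
  filter_upwards [ae_restrict_mem measurableSet_Ioi] with u hu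
  have hu' : 0 < u := h2.trans hu
  rw [abs_neg, Real.abs_exp, Real.log_exp, abs_neg, abs_of_pos hu', smul_eq_mul, ← mul_assoc,
    mul_inv_cancel₀ (Real.exp_pos _).ne', one_mul]

/-- The dominating function for the kernel of `U₀ Q^β`. -/
noncomputable def smoothWeight (δ t : ℝ) : ℝ :=
  q t ^ δ * (t ^ (-(1 / 2) : ℝ) * ((2 + t / 2) * Real.exp (-(t / 2))))

theorem measurable_smoothWeight (δ : ℝ) : Measurable (smoothWeight δ) := by
  have := measurable_q
  unfold smoothWeight
  fun_prop

theorem smoothWeight_nonneg {t : ℝ} (ht : 0 < t) (δ : ℝ) : 0 ≤ smoothWeight δ t := by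
  have := q_pos ht
  unfold smoothWeight
  positivity

theorem two_add_mul_exp_le {x : ℝ} (hx : 0 ≤ x) : (2 + x) * Real.exp (-x) ≤ 2 := by
  rw [Real.exp_neg, ← div_eq_mul_inv, div_le_iff₀ (Real.exp_pos _)]
  linarith [Real.add_one_le_exp x]

theorem two_add_mul_exp_le' {x : ℝ} (hx : 0 ≤ x) :
    (2 + x) * Real.exp (-x) ≤ 4 * Real.exp (-(x / 2)) := by
  have h1 := two_add_mul_exp_le (x := x / 2) (by linarith)
  have h3 : Real.exp (-x) = Real.exp (-(x / 2)) * Real.exp (-(x / 2)) := by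
    rw [← Real.exp_add]
    ring_nf
  have h4 := Real.exp_pos (-(x / 2))
  rw [h3]
  nlinarith

/-- Near zero the square is at most `4 t⁻¹ |log t|^{-2δ}`, and `2δ > 1` makes this integrable. For
`t ≥ 1/2` exponential decay suffices. -/
theorem memLp_smoothWeight {δ : ℝ} (hδ : 1 / 2 < δ) :
    MemLp (smoothWeight δ) 2 (volume.restrict (Ioi 0)) := by
  have hm := measurable_smoothWeight δ
  rw [memLp_two_iff_integrable_sq hm.aestronglyMeasurable]
  have hsplit : Ioi (0 : ℝ) = Ioo 0 (1 / 2) ∪ Ici (1 / 2) := by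
    rw [Ioo_union_Ici_eq_Ioi (by norm_num)]
  have hroot : ∀ t : ℝ, 0 < t → (t ^ (-(1 / 2) : ℝ)) ^ 2 = t⁻¹ := by
    intro t ht
    rw [← Real.rpow_natCast, ← Real.rpow_mul ht.le]
    norm_num
    exact Real.rpow_neg_one t
  change IntegrableOn (fun t ↦ smoothWeight δ t ^ 2) (Ioi 0)
  rw [hsplit]
  refine IntegrableOn.union ?_ ?_
  · refine ((integrableOn_inv_mul_abs_log_rpow (show 1 < 2 * δ by linarith)).const_mul 4).mono'
      (by fun_prop) ?_
    filter_upwards [ae_restrict_mem measurableSet_Ioo] with t ht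
    have ht0 : 0 < t := ht.1
    have hl : 0 < |Real.log t| := abs_pos.2 (Real.log_neg ht0 (by linarith [ht.2])).ne
    have e1 : (q t ^ δ) ^ 2 = |Real.log t| ^ (-(2 * δ)) := by
      rw [q, if_pos ht.2, ← Real.rpow_natCast, ← Real.rpow_mul (by positivity), Real.inv_rpow hl.le,
        ← Real.rpow_neg hl.le]
      congr 1
      push_cast
      ring
    have e2 := two_add_mul_exp_le (half_pos ht0).le
    have e3 : 0 ≤ (2 + t / 2) * Real.exp (-(t / 2)) := by positivity
    have e4 : ((2 + t / 2) * Real.exp (-(t / 2))) ^ 2 ≤ 4 := by nlinarith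
    rw [Real.norm_eq_abs, abs_of_nonneg (sq_nonneg _), smoothWeight, mul_pow, e1, mul_pow, hroot t ht0]
    have e5 : 0 ≤ |Real.log t| ^ (-(2 * δ)) * t⁻¹ := by positivity
    nlinarith
  · have h1 : IntegrableOn (fun t : ℝ ↦ Real.exp (-((1 / 2) * t))) (Ici (1 / 2)) :=
      (integrableOn_exp_neg_mul (a := 1 / 2) (by norm_num)).mono_set fun t ht ↦
        lt_of_lt_of_le (by norm_num) (mem_Ici.1 ht)
    refine (h1.const_mul (((Real.log 2)⁻¹ ^ δ) ^ 2 * 2 * 16)).mono' (by fun_prop) ?_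
    filter_upwards [ae_restrict_mem measurableSet_Ici] with t ht
    have ht1 : 1 / 2 ≤ t := ht
    have ht0 : 0 < t := by linarith
    have e1 := two_add_mul_exp_le' (half_pos ht0).le
    have e2 : 0 ≤ (2 + t / 2) * Real.exp (-(t / 2)) := by positivity
    have e3 : ((2 + t / 2) * Real.exp (-(t / 2))) ^ 2 ≤ 16 * Real.exp (-((1 / 2) * t)) := by
      refine (pow_le_pow_left₀ e2 e1 2).trans_eq ?_
      rw [mul_pow, ← Real.exp_nat_mul]
      ring_nf
    have e4 : t⁻¹ ≤ 2 := by
      rw [inv_le_comm₀ ht0 two_pos]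
      linarith
    rw [Real.norm_eq_abs, abs_of_nonneg (sq_nonneg _), smoothWeight, mul_pow, mul_pow, hroot t ht0,
      q, if_neg (not_lt.2 ht1), mul_assoc, mul_assoc]
    gcongr

/-- The logarithmic loss is at most a constant times `q^{-γ}`, so the weight exponent drops from `β`
to `β - γ`. -/
theorem abs_le_smoothWeight {t β γ y c : ℝ} (ht : 0 < t) (hc : 0 ≤ c) (h0 : 0 ≤ γ)
    (hy : |y| ≤ c * (max (Real.log (2 / (t / 2))) 0 ^ γ + 1) * ((2 + t / 2) * Real.exp (-(t / 2)))) :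
    |q t ^ β * (t ^ (-(1 / 2) : ℝ) * y)| ≤ c * (3 ^ γ + 2 ^ γ) * smoothWeight (β - γ) t := by
  have hq := q_pos ht
  have e1 := max_log_rpow_add_one_le ht h0
  have e2 : q t ^ (β - γ) = q t ^ β * q t ^ (-γ) := by rw [← Real.rpow_add hq, sub_eq_add_neg]
  rw [abs_mul, abs_mul, abs_of_pos (Real.rpow_pos_of_pos hq β),
    abs_of_pos (Real.rpow_pos_of_pos ht _), smoothWeight, e2]
  calc q t ^ β * (t ^ (-(1 / 2) : ℝ) * |y|)
      ≤ q t ^ β * (t ^ (-(1 / 2) : ℝ) * (c * ((3 ^ γ + 2 ^ γ) * q t ^ (-γ))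
        * ((2 + t / 2) * Real.exp (-(t / 2))))) := by
        gcongr
        exact hy.trans (by gcongr)
    _ = _ := by ring

/-! ### Strong smoothness. -/

/-- The kernel of the functional `f ↦ (U₀ Q^β f)(x)`. -/
noncomputable def smoothKern (β x t : ℝ) : ℝ := q t ^ β * kern x t

theorem measurable_smoothKern (β x : ℝ) : Measurable (smoothKern β x) := by
  have h1 : Measurable (kern x) := Measurable.of_uncurry_left (f := kern) measurable_kern
  have h2 := measurable_q
  unfold smoothKern
  fun_prop

theorem abs_smoothKern_le (β : ℝ) {γ x t : ℝ} (h0 : 0 ≤ γ) (hx : x ∈ Ioo 0 Real.pi) (ht : 0 < t) :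
    |smoothKern β x t| ≤ amp x * ((3 ^ γ + 2 ^ γ) * smoothWeight (β - γ) t) := by
  have h1 := abs_sinBessel_le (half_pos ht) (kappa x)
  have ha := amp_pos hx
  have h2 := abs_le_smoothWeight (β := β) (y := sinBessel (kappa x) (t / 2)) ht zero_le_one h0 (by
    refine h1.trans ?_
    have e1 : 0 ≤ max (Real.log (2 / (t / 2))) 0 ^ γ := Real.rpow_nonneg (le_max_right _ _) _
    have e2 := Real.exp_pos (-(t / 2))
    rw [one_mul]
    calc Real.exp (-(t / 2)) = 1 * (1 * Real.exp (-(t / 2))) := by ring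
      _ ≤ _ := by
        gcongr
        · linarith
        · linarith)
  rw [smoothKern, kern, mul_left_comm, abs_mul, abs_of_pos ha]
  rw [one_mul] at h2
  gcongr

theorem memLp_smoothKern {β x : ℝ} (hβ : 1 / 2 < β) (hx : x ∈ Ioo 0 Real.pi) :
    MemLp (fun t ↦ (smoothKern β x t : ℂ)) 2 (volume.restrict (Ioi 0)) := by
  refine MemLp.ofReal (f := smoothKern β x) ?_
  have h1 := ((memLp_smoothWeight hβ).const_mul (3 ^ (0 : ℝ) + 2 ^ (0 : ℝ))).const_mul (amp x)
  refine h1.of_le (measurable_smoothKern β x).aestronglyMeasurable ?_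
  filter_upwards [ae_restrict_mem measurableSet_Ioi] with t ht
  have h2 := abs_smoothKern_le β le_rfl hx ht
  rw [sub_zero] at h2
  exact h2.trans (le_abs_self _)

/-- Turns a Lipschitz bound on an interval of length `D` into a Hölder bound. -/
theorem rpow_one_sub_mul_le {d D γ : ℝ} (hd : 0 ≤ d) (hdD : d ≤ D) (h1 : γ < 1) :
    d ≤ D ^ (1 - γ) * d ^ γ := by
  rcases hd.eq_or_lt with rfl | hd'
  · have : (0 : ℝ) ≤ D ^ (1 - γ) * 0 ^ γ := by positivity
    exact this
  · calc d = d ^ (1 - γ) * d ^ γ := by rw [← Real.rpow_add hd']; simp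
      _ ≤ _ := by
        have : 0 ≤ 1 - γ := by linarith
        gcongr

theorem exists_lipschitz {f : ℝ → ℝ} {a b : ℝ} {s : Set ℝ} (hs : IsOpen s) (hab : Icc a b ⊆ s)
    (hf : ContDiffOn ℝ 1 f s) :
    ∃ L, 0 ≤ L ∧ ∀ x ∈ Icc a b, ∀ y ∈ Icc a b, |f x - f y| ≤ L * |x - y| := by
  have hcont : ContinuousOn (deriv f) (Icc a b) :=
    (hf.continuousOn_deriv_of_isOpen hs le_rfl).mono hab
  obtain ⟨C, hC⟩ := isCompact_Icc.exists_bound_of_continuousOn hcont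
  refine ⟨max C 0, le_max_right _ _, fun x hx y hy ↦ ?_⟩
  have h1 := (convex_Icc a b).norm_image_sub_le_of_norm_deriv_le (f := f) (C := max C 0)
    (fun z hz ↦ (hf.differentiableOn one_ne_zero).differentiableAt (hs.mem_nhds (hab hz)))
    (fun z hz ↦ (hC z hz).trans (le_max_left _ _)) hy hx
  simpa [Real.norm_eq_abs] using h1

theorem exists_smoothKern_sub_le {a b : ℝ} (hab : Icc a b ⊆ Ioo 0 Real.pi) (β : ℝ) {γ : ℝ}
    (h0 : 0 < γ) (h1 : γ < 1) :
    ∃ C, 0 ≤ C ∧ ∀ x ∈ Icc a b, ∀ y ∈ Icc a b, ∀ t, 0 < t →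
      |smoothKern β x t - smoothKern β y t| ≤ C * |x - y| ^ γ * smoothWeight (β - γ) t := by
  obtain ⟨M, hM⟩ := exists_amp_le hab
  obtain ⟨L, hL0, hL⟩ := exists_lipschitz isOpen_Ioo hab contDiffOn_amp
  obtain ⟨K, hK0, hK⟩ := exists_lipschitz isOpen_Ioo hab contDiffOn_kappa
  have hM0 : 0 ≤ max M 0 := le_max_right _ _
  set B := 3 ^ γ + (2 : ℝ) ^ γ with hB
  have hB0 : 0 ≤ B := by positivity
  -- The first term comes from varying the amplitude, which is Lipschitz on the compact interval;
  -- the second from varying `kappa`, Lipschitz with constant `K`, inside the Hölder bound for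
  -- `sinBessel`.
  refine ⟨(L * |b - a| ^ (1 - γ) + max M 0 * (2 * K ^ γ)) * B, by positivity,
    fun x hx y hy t ht ↦ ?_⟩
  set W := smoothWeight (β - γ) t with hW
  have hW0 : 0 ≤ W := smoothWeight_nonneg ht _
  have hd : |x - y| ≤ |b - a| := by
    refine (abs_le.2 ⟨?_, ?_⟩).trans (le_abs_self _) <;> linarith [hx.1, hx.2, hy.1, hy.2]
  have e1 : |amp x - amp y| ≤ L * |b - a| ^ (1 - γ) * |x - y| ^ γ := by
    rw [mul_assoc]
    exact (hL x hx y hy).trans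
      (mul_le_mul_of_nonneg_left (rpow_one_sub_mul_le (abs_nonneg _) hd h1) hL0)
  have e2 : |kappa x - kappa y| ^ γ ≤ K ^ γ * |x - y| ^ γ := by
    rw [← Real.mul_rpow hK0 (abs_nonneg _)]
    exact Real.rpow_le_rpow (abs_nonneg _) (hK x hx y hy) h0.le
  have e3 : |q t ^ β * (t ^ (-(1 / 2) : ℝ) * sinBessel (kappa x) (t / 2))| ≤ B * W := by
    have h2 := abs_smoothKern_le β h0.le (hab hx) ht
    rw [smoothKern, kern, mul_left_comm, abs_mul, abs_of_pos (amp_pos (hab hx))] at h2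
    exact le_of_mul_le_mul_left h2 (amp_pos (hab hx))
  have e4 : |q t ^ β * (t ^ (-(1 / 2) : ℝ)
      * (sinBessel (kappa x) (t / 2) - sinBessel (kappa y) (t / 2)))|
      ≤ 2 * (K ^ γ * |x - y| ^ γ) * B * W := by
    refine abs_le_smoothWeight ht (by positivity) h0.le ?_
    refine (abs_sinBessel_sub_le (half_pos ht) _ _ h0.le h1.le).trans ?_
    have : 0 ≤ max (Real.log (2 / (t / 2))) 0 ^ γ := Real.rpow_nonneg (le_max_right _ _) _
    gcongr
  have e5 : smoothKern β x t - smoothKern β y t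
      = (amp x - amp y) * (q t ^ β * (t ^ (-(1 / 2) : ℝ) * sinBessel (kappa x) (t / 2)))
        + amp y * (q t ^ β * (t ^ (-(1 / 2) : ℝ)
          * (sinBessel (kappa x) (t / 2) - sinBessel (kappa y) (t / 2)))) := by
    rw [smoothKern, smoothKern, kern, kern]
    ring
  rw [e5]
  refine (abs_add_le _ _).trans ?_
  rw [abs_mul (amp x - amp y), abs_mul (amp y)]
  calc _ ≤ (L * |b - a| ^ (1 - γ) * |x - y| ^ γ) * (B * W)
        + max M 0 * (2 * (K ^ γ * |x - y| ^ γ) * B * W) := by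
        gcongr
        exact (abs_of_pos (amp_pos (hab hy))).trans_le <| (hM y hy).trans (le_max_left _ _)
    _ = _ := by ring

open Classical in
/-- The functional `f ↦ (U₀ Q^β f)(x)`. -/
noncomputable def smoothFunctional (β x : ℝ) : L2 (Ioi 0) →L[ℂ] ℂ :=
  -- The default value plays no role: for `β > 1/2` and `x` in `(0, π)` the first branch is taken.
  if h : MemLp (fun t ↦ (smoothKern β x t : ℂ)) 2 (volume.restrict (Ioi 0)) then
    innerSL ℂ (h.toLp _) else 0

theorem smoothFunctional_apply {β x : ℝ} (hβ : 1 / 2 < β) (hx : x ∈ Ioo 0 Real.pi)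
    (f : L2 (Ioi 0)) :
    smoothFunctional β x f = inner ℂ ((memLp_smoothKern hβ hx).toLp _) f := by
  rw [smoothFunctional, dif_pos (memLp_smoothKern hβ hx), innerSL_apply_apply]

theorem isStronglySmooth_Qpow {U : L2 (Ioi 0) ≃ₗᵢ[ℂ] L2 (Ioo 0 Real.pi)}
    (hU : ∀ v : ℝ, 0 < v → U ((memLp_expVec v).toLp _) = (memLp_sineVec v).toLp _)
    {β : ℝ} (hβ : 1 / 2 < β) (hβ0 : 0 < β) {γ : ℝ} (hγ0 : 0 < γ) (hγ : γ < min 1 (β - 1 / 2)) :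
    IsStronglySmooth U (Qpow β hβ0) γ := by
  have hγ1 : γ < 1 := hγ.trans_le (min_le_left _ _)
  have hδ : 1 / 2 < β - γ := by linarith [hγ.trans_le (min_le_right 1 (β - 1 / 2))]
  refine ⟨smoothFunctional β, fun f ↦ ?_, fun a b ha _ hb ↦ ?_⟩
  · have hQ := mulOp_coeFn (fun t ↦ ((q t ^ β : ℝ) : ℂ)) (memLp_q_rpow hβ0) f
    -- By Cauchy–Schwarz this makes `Q^β f` integrable against `kernWeight`, so the kernel formula
    -- for `U` applies to it.
    have hw : MemLp (fun t ↦ ((q t ^ β * kernWeight t : ℝ) : ℂ)) 2 (volume.restrict (Ioi 0)) := by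
      refine MemLp.ofReal (f := fun t ↦ q t ^ β * kernWeight t) ?_
      refine (memLp_smoothWeight hβ).of_le
        ((measurable_q.pow_const β).mul measurable_kernWeight).aestronglyMeasurable ?_
      filter_upwards [ae_restrict_mem measurableSet_Ioi] with t ht
      have ht' : (0 : ℝ) < t := ht
      have h1 := q_pos ht'
      have h2 := kernWeight_pos ht'
      refine le_trans ?_ (le_abs_self _)
      rw [Real.norm_eq_abs, abs_of_pos (by positivity), kernWeight, smoothWeight]
      gcongr
      exact le_mul_of_one_le_left (Real.exp_pos _).le (by linarith)
    have h1 := ae_eq_integral_kern hU (Qpow β hβ0 f) (by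
      refine (hw.integrable_mul (Lp.memLp f)).congr ?_
      filter_upwards [hQ] with t ht
      rw [Qpow, ht, Pi.mul_apply]
      push_cast
      ring)
    filter_upwards [h1, ae_restrict_mem measurableSet_Ioo] with x hx hx'
    rw [hx, smoothFunctional_apply hβ hx', inner_toLp_ofReal]
    refine integral_congr_ae ?_
    filter_upwards [hQ] with t ht
    rw [Qpow, ht, smoothKern]
    push_cast
    ring
  · have hab : Icc a b ⊆ Ioo 0 Real.pi := fun x hx ↦ ⟨ha.trans_le hx.1, hx.2.trans_lt hb⟩
    obtain ⟨M, hM⟩ := exists_amp_le hab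
    obtain ⟨C, hC0, hC⟩ := exists_smoothKern_sub_le hab β hγ0 hγ1
    have hW := memLp_smoothWeight hδ
    set N : ℝ := ‖hW.toLp _‖ with hN
    have hN0 : 0 ≤ N := norm_nonneg _
    -- Both estimates reduce to `L²` norms of the representing kernels, bounded pointwise by
    -- multiples of the one function `smoothWeight (β - γ)`.
    have hnorm : ∀ (g : L2 (Ioi 0)) (c : ℝ),
        (∀ᵐ t ∂volume.restrict (Ioi (0 : ℝ)), ‖g t‖ ≤ c * smoothWeight (β - γ) t) →
        ‖g‖ ≤ c * N := by
      intro g c hg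
      refine Lp.norm_le_mul_norm_of_ae_le_mul ?_
      filter_upwards [hg, hW.coeFn_toLp, ae_restrict_mem measurableSet_Ioi] with t h1 h2 h3
      rwa [h2, Real.norm_eq_abs, abs_of_nonneg (smoothWeight_nonneg h3 _)]
    set B := 3 ^ γ + (2 : ℝ) ^ γ with hB
    have hB0 : 0 ≤ B := by positivity
    have hbound : ∀ (x : ℝ) (hx : x ∈ Icc a b),
        ‖(memLp_smoothKern hβ (hab hx)).toLp _‖ ≤ max M 0 * B * N := by
      intro x hx
      refine hnorm _ _ ?_
      filter_upwards [(memLp_smoothKern hβ (hab hx)).coeFn_toLp, ae_restrict_mem measurableSet_Ioi]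
        with t h1 h2
      rw [h1, Complex.norm_real, mul_assoc]
      refine (abs_smoothKern_le β hγ0.le (hab hx) h2).trans ?_
      have := smoothWeight_nonneg h2 (β - γ)
      gcongr
      exact (hM x hx).trans (le_max_left _ _)
    have hdiff : ∀ (x : ℝ) (hx : x ∈ Icc a b) (y : ℝ) (hy : y ∈ Icc a b),
        ‖(memLp_smoothKern hβ (hab hx)).toLp _ - (memLp_smoothKern hβ (hab hy)).toLp _‖
          ≤ C * |x - y| ^ γ * N := by
      intro x hx y hy
      refine hnorm _ _ ?_
      filter_upwards [(memLp_smoothKern hβ (hab hx)).coeFn_toLp,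
        (memLp_smoothKern hβ (hab hy)).coeFn_toLp,
        Lp.coeFn_sub ((memLp_smoothKern hβ (hab hx)).toLp _) ((memLp_smoothKern hβ (hab hy)).toLp _),
        ae_restrict_mem measurableSet_Ioi] with t h1 h2 h3 h4
      rw [h3, Pi.sub_apply, h1, h2, ← Complex.ofReal_sub, Complex.norm_real]
      exact hC x hx y hy t h4
    have hMB : 0 ≤ max M 0 * B * N := mul_nonneg (mul_nonneg (le_max_right _ _) hB0) hN0
    refine ⟨max M 0 * B * N + C * N, fun f ↦ ⟨fun x hx ↦ ?_, fun x hx y hy ↦ ?_⟩⟩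
    · rw [smoothFunctional_apply hβ (hab hx)]
      refine (norm_inner_le_norm _ _).trans ?_
      gcongr
      exact (hbound x hx).trans (le_add_of_nonneg_right (by positivity))
    · rw [smoothFunctional_apply hβ (hab hx), smoothFunctional_apply hβ (hab hy), ← inner_sub_left]
      refine (norm_inner_le_norm _ _).trans ?_
      gcongr
      refine (hdiff x hx y hy).trans ?_
      have : 0 ≤ |x - y| ^ γ := Real.rpow_nonneg (abs_nonneg _) _
      nlinarith

end HankelSmooth

theorem mainTheorem6 :
    ∃ (H : HankelSmooth.L2 (Set.Ioi 0) →L[ℂ] HankelSmooth.L2 (Set.Ioi 0))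
      (U₀ : HankelSmooth.L2 (Set.Ioi 0) ≃ₗᵢ[ℂ] HankelSmooth.L2 (Set.Ioo 0 Real.pi)),
      HankelSmooth.IsHankel HankelSmooth.hStar H ∧
      HankelSmooth.ExtendsTransform U₀ ∧
      HankelSmooth.Diagonalises U₀ H ∧
      ∀ (β : ℝ) (hβ : 1 / 2 < β) (γ : ℝ), 0 < γ → γ < min 1 (β - 1 / 2) →
        HankelSmooth.IsStronglySmooth U₀
          (HankelSmooth.Qpow β (lt_trans one_half_pos hβ)) γ := by
  obtain ⟨U, hU⟩ := HankelSmooth.exists_unitary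
  exact ⟨HankelSmooth.hankelOp U, U, HankelSmooth.isHankel_hankelOp hU,
    HankelSmooth.extendsTransform hU, HankelSmooth.diagonalises_hankelOp,
    fun β hβ γ h0 h1 ↦ HankelSmooth.isStronglySmooth_Qpow hU hβ _ h0 h1⟩
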